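/- Let $d\ge 1$ and let $B=B(|v-v_*|,\cos\theta)\ge 0$ be a measurable collision kernel that is bounded for bounded relative speeds. For $R>0$ and a function $f$ that is $2\pi$-periodic in each coordinate of $\mathbb R^d$, let $$Q^R(f,f)(v)=\int_{|q|<2R}\int_{\mathbb S^{d-1}}B\big(|q|,\tfrac{q}{|q|}\cdot\sigma\big)\,\big(f(v'_*)f(v')-f(v_*)f(v)\big)\,d\sigma\,dq,$$ where $v_*=v-q$, $v'=v-\tfrac q2+\tfrac{|q|}2\sigma$, $v'_*=v-\tfrac q2-\tfrac{|q|}2\sigma$. Let $\Phi(v)=(1,v_1,\dots,v_d,|v|^2)^T$, $\langle f,\Phi\rangle=\int_{[-\pi,\pi]^d}f\,\Phi\,dv$, and let $\|\cdot\|_2$ be the Euclidean norm of a vector. Let $H^r_p$ be the Sobolev space of periodic functions on $[-\pi,\pi]^d$, with $\|f\|_{H^r_p}^2=\sum_{|\alpha|\le r}\|\partial^\alpha f\|_{L^2}^2$, and let $\mathbb P^N=\mathrm{span}\{e^{ik\cdot v}: k\in\mathbb Z^d,\ |k_j|\le N\}$. For $N\ge 1$ define $$f_N^c=\mathrm{argmin}\{\|g-f\|_{L^2}: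 g\in\mathbb P^N,\ \langle g,\Phi\rangle=\langle f,\Phi\rangle\},$$ $$Q_N^{R,c}(f,f)=\mathrm{argmin}\{\|g-Q^R(f,f)\|_{L^2}: g\in\mathbb P^N,\ \langle g,\Phi\rangle=0\}.$$ Let $r\ge 1$ be an integer and let $\tilde C$ be a real constant. There is a constant $C=C(\|f\|_{H^r_p},R)$, which apart from $d,B,r,\tilde C$ depends only on the two quantities shown, such that the following holds for all integers $N\ge 1$, all $R>0$, all $\delta'\ge 0$ and all (real- or complex-valued) $f\in H^r_p$. If $$\|\langle Q^R(f,f),\Phi\rangle\|_2\le\tilde C\,\delta' N^{-r},$$ then the minimizers $f_N^c$ and $Q_N^{R,c}(f_N^c,f_N^c)$ exist and are unique, $Q^R(f_N^c,f_N^c)\in H^r_p$, and $$\|Q^R(f,f)-Q_N^{R,c}(f_N^c,f_N^c)\|_{L^2}\le\frac{C}{N^r}\Big(\|f\|_{H^r_p}+\|Q^R(f_N^c,f_N^c)\|_{H^r_p}+\delta'\Big).$$ -/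

import Mathlib

open MeasureTheory
open scoped ContDiff

noncomputable section

namespace BoltzmannSpectral

/-- Lebesgue measure on the velocity cube `[-π, π]^d`. -/
def cubeMeasure (d : ℕ) : Measure (EuclideanSpace ℝ (Fin d)) :=
  volume.restrict {v | ∀ j, v j ∈ Set.Icc (-Real.pi) Real.pi}

/-- `f` is `2π`-periodic in each coordinate. -/
def IsPeriodic {d : ℕ} (f : EuclideanSpace ℝ (Fin d) → ℂ) : Prop :=
  ∀ (j : Fin d) (v : EuclideanSpace ℝ (Fin d)),
    f (v + EuclideanSpace.single j (2 * Real.pi)) = f v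

/-! ### Periodic Sobolev spaces -/

/-- The classical partial derivative `∂_j φ`. -/
def partialDeriv {d : ℕ} (j : Fin d) (φ : EuclideanSpace ℝ (Fin d) → ℂ) :
    EuclideanSpace ℝ (Fin d) → ℂ :=
  fun v => fderiv ℝ φ v (EuclideanSpace.single j 1)

/-- The classical mixed partial derivative `∂^α φ = ∂_0^{α_0} ⋯ ∂_{d-1}^{α_{d-1}} φ`. -/
def mixedPartial {d : ℕ} (α : Fin d → ℕ) (φ : EuclideanSpace ℝ (Fin d) → ℂ) :
    EuclideanSpace ℝ (Fin d) → ℂ :=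
  (List.finRange d).foldr (fun j g => (partialDeriv j)^[α j] g) φ

/-- `g ∈ L²([-π, π]^d)` is the weak derivative `∂^α f` of the periodic function `f`: integration by
parts holds over a period against every smooth periodic test function. -/
def IsWeakDeriv {d : ℕ} (α : Fin d → ℕ) (f g : EuclideanSpace ℝ (Fin d) → ℂ) : Prop :=
  MemLp g 2 (cubeMeasure d) ∧
    ∀ φ : EuclideanSpace ℝ (Fin d) → ℂ, ContDiff ℝ ∞ φ → IsPeriodic φ →
      ∫ v, f v * mixedPartial α φ v ∂(cubeMeasure d)
        = (-1) ^ (∑ j, α j) * ∫ v, g v * φ v ∂(cubeMeasure d)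

/-- The periodic Sobolev space `H^r_p([-π, π]^d)`: periodic `L²` functions whose weak derivatives
of order at most `r` exist in `L²`. -/
def MemHrp {d : ℕ} (r : ℕ) (f : EuclideanSpace ℝ (Fin d) → ℂ) : Prop :=
  IsPeriodic f ∧ MemLp f 2 (cubeMeasure d) ∧
    ∀ α : Fin d → ℕ, ∑ j, α j ≤ r → ∃ g, IsWeakDeriv α f g

open Classical in
/-- The weak derivative `∂^α f` (unique almost everywhere), with value `0` if there is none. -/
def weakDeriv {d : ℕ} (α : Fin d → ℕ) (f : EuclideanSpace ℝ (Fin d) → ℂ) :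
    EuclideanSpace ℝ (Fin d) → ℂ :=
  if h : ∃ g, IsWeakDeriv α f g then h.choose else 0

/-- The multi-indices of order at most `r`. -/
def multiIndices (d r : ℕ) : Finset (Fin d → ℕ) :=
  (Fintype.piFinset fun _ => Finset.range (r + 1)).filter fun α => ∑ j, α j ≤ r

/-- The norm of `H^r_p`: `‖f‖² = ∑_{|α| ≤ r} ‖∂^α f‖²_{L²}`. -/
def hrpNorm {d : ℕ} (r : ℕ) (f : EuclideanSpace ℝ (Fin d) → ℂ) : ℝ :=
  Real.sqrt (∑ α ∈ multiIndices d r, (eLpNorm (weakDeriv α f) 2 (cubeMeasure d)).toReal ^ 2)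

/-! ### Trigonometric polynomials and moments -/

/-- The Fourier mode `v ↦ e^{i k · v}`. -/
def fourierMode {d : ℕ} (k : Fin d → ℤ) : EuclideanSpace ℝ (Fin d) → ℂ :=
  fun v => Complex.exp (Complex.I * ∑ j, (k j : ℂ) * (v j : ℂ))

/-- The space `ℙ^N` of trigonometric polynomials of degree at most `N` in each coordinate. -/
def trigPoly (d N : ℕ) : Submodule ℂ (EuclideanSpace ℝ (Fin d) → ℂ) :=
  Submodule.span ℂ (fourierMode '' {k : Fin d → ℤ | ∀ j, -(N : ℤ) ≤ k j ∧ k j ≤ N})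

/-- The components of `Φ(v) = (1, v_1, …, v_d, |v|²)`. -/
def collisionInvariant {d : ℕ} :
    Unit ⊕ Fin d ⊕ Unit → EuclideanSpace ℝ (Fin d) → ℝ
  | Sum.inl _, _ => 1
  | Sum.inr (Sum.inl j), v => v j
  | Sum.inr (Sum.inr _), v => ‖v‖ ^ 2

/-- The moment vector `⟨f, Φ⟩` over the cube. -/
def moments {d : ℕ} (f : EuclideanSpace ℝ (Fin d) → ℂ) :
    EuclideanSpace ℂ (Unit ⊕ Fin d ⊕ Unit) :=
  WithLp.toLp 2 fun i => ∫ v, f v * (collisionInvariant i v : ℂ) ∂(cubeMeasure d)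

/-- `g = argmin {‖h - F‖_{L²} : h ∈ ℙ^N, ⟨h, Φ⟩ = U}`. -/
def IsConstrainedBestApprox {d : ℕ} (N : ℕ) (F : EuclideanSpace ℝ (Fin d) → ℂ)
    (U : EuclideanSpace ℂ (Unit ⊕ Fin d ⊕ Unit)) (g : EuclideanSpace ℝ (Fin d) → ℂ) : Prop :=
  g ∈ trigPoly d N ∧ moments g = U ∧
    ∀ h ∈ trigPoly d N, moments h = U →
      eLpNorm (g - F) 2 (cubeMeasure d) ≤ eLpNorm (h - F) 2 (cubeMeasure d)

/-! ### The truncated, periodized collision operator -/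

/-- A collision kernel `B(|v - v_*|, cos θ)`: nonnegative, measurable, and bounded for bounded
relative speeds. -/
structure IsCollisionKernel (B : ℝ → ℝ → ℝ) : Prop where
  measurable : Measurable (Function.uncurry B)
  nonneg : ∀ s c : ℝ, 0 ≤ s → |c| ≤ 1 → 0 ≤ B s c
  locallyBounded : ∀ S : ℝ, ∃ K : ℝ, ∀ s c : ℝ, 0 ≤ s → s ≤ S → |c| ≤ 1 → B s c ≤ K

/-- The operator `Q^R(f, f)`, written with the relative velocity `q = v - v_*`, `|q| < 2R`, so that
`v' = v - q/2 + |q|σ/2` and `v'_* = v - q/2 - |q|σ/2`; `σ` is integrated with respect to the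
surface measure of the unit sphere. -/
def collisionOp {d : ℕ} (B : ℝ → ℝ → ℝ) (R : ℝ) (f : EuclideanSpace ℝ (Fin d) → ℂ) :
    EuclideanSpace ℝ (Fin d) → ℂ :=
  fun v => ∫ p : EuclideanSpace ℝ (Fin d) × Metric.sphere (0 : EuclideanSpace ℝ (Fin d)) 1,
    ((B ‖p.1‖ (inner ℝ (‖p.1‖⁻¹ • p.1) (p.2 : EuclideanSpace ℝ (Fin d))) : ℝ) : ℂ) *
      (f (v - (1 / 2 : ℝ) • p.1 - (‖p.1‖ / 2) • (p.2 : EuclideanSpace ℝ (Fin d))) *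
          f (v - (1 / 2 : ℝ) • p.1 + (‖p.1‖ / 2) • (p.2 : EuclideanSpace ℝ (Fin d)))
        - f (v - p.1) * f v)
    ∂((volume.restrict (Metric.ball (0 : EuclideanSpace ℝ (Fin d)) (2 * R))).prod
      (volume : Measure (EuclideanSpace ℝ (Fin d))).toSphere)

end BoltzmannSpectral

end

open BoltzmannSpectral

namespace BoltzmannSpectral

open scoped ENNReal NNReal Pointwise RealInnerProductSpace

/-! Write `g = f_N^c` and `q = Q_N^{R,c}(g,g)`, and split the error as `‖Q(f,f) - Q(g,g)‖ + ‖Q(g,g)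
- q‖`. Two facts control it.

(a) A constrained best approximation is as good as the Fourier projection `P_N F`, up to the moment
defect of the data: `‖F - g‖ ≤ K (‖F - P_N F‖ + ‖U - ⟨F,Φ⟩‖)`, with `K` independent of `N`
(`exists_l2Norm_sub_le_of_isConstrainedBestApprox`). The moment map is already onto from `ℙ^1`
(`trigMoments_surjective`), so the missing moments can be added to `P_N F` by a degree-one
polynomial of comparable size. For `F = f` the defect is zero, and spectral accuracy
(`MemHrp.l2Norm_sub_fourierProj_le`) gives `‖f - g‖ = O(N^{-r})`.

(b) `Q^R` is a bounded quadratic map on periodic `L²`, hence Lipschitz on bounded sets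
(`exists_collisionOp_bound`). So `Q(f,f) - Q(g,g)` is `O(N^{-r})` as well. By the hypothesis on
`⟨Q(f,f),Φ⟩`, the moments of `Q(g,g)` are then also `O(N^{-r})`, and (a) with `F = Q(g,g)`, `U = 0`
finishes. The Sobolev regularity of `Q(g,g)` is free, since it is a trigonometric polynomial of
degree at most `2N`.

The analytic core is (b), an `L² × L² → L²` bound for the gain term (`lintegral_sq_gain_le`). Where
`q·σ ≥ 0`, the map `q ↦ v'_*` at fixed `v, σ` expands distances up to the factor `1/8`, so the
integral of `|f(v'_*)|` is at most a constant times `‖f‖_{L¹}`, uniformly in `v`. Cauchy–Schwarz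
with the weight `|f(v'_*)|`, followed by a translation to base point `v'`, leaves `|f(v' - |q|σ)|
|g(v')|²`; and `dq dσ` is carried by `(q,σ) ↦ |q|σ` to a multiple of Lebesgue measure. Where `q·σ ≤
0`, the particles exchange roles. -/

variable {d : ℕ}

/-! ### The period lattice and integration over a period cell. -/

/-- Periodicity with period `2π` in each coordinate, for functions with values in any type. -/
def HasPeriods {α : Type*} (f : EuclideanSpace ℝ (Fin d) → α) : Prop :=
  ∀ (j : Fin d) (v : EuclideanSpace ℝ (Fin d)),
    f (v + EuclideanSpace.single j (2 * Real.pi)) = f v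

/-- The basis `2π e_j` of the period lattice. -/
noncomputable def latticeBasis (d : ℕ) : Module.Basis (Fin d) ℝ (EuclideanSpace ℝ (Fin d)) :=
  (EuclideanSpace.basisFun (Fin d) ℝ).toBasis.isUnitSMul
    (w := fun _ => 2 * Real.pi) fun _ => (by positivity : (2 * Real.pi) ≠ 0).isUnit

lemma latticeBasis_apply (j : Fin d) :
    latticeBasis d j = EuclideanSpace.single j (2 * Real.pi) := by
  rw [latticeBasis, Module.Basis.isUnitSMul_apply]
  ext i
  simp

lemma latticeBasis_repr (v : EuclideanSpace ℝ (Fin d)) (j : Fin d) :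
    (latticeBasis d).repr v j = (2 * Real.pi)⁻¹ * v j := by
  rw [latticeBasis, Module.Basis.repr_isUnitSMul]
  simp [Units.smul_def]

lemma HasPeriods.add_mem {α : Type*} {f : EuclideanSpace ℝ (Fin d) → α} (hf : HasPeriods f)
    {g : EuclideanSpace ℝ (Fin d)}
    (hg : g ∈ Submodule.span ℤ (Set.range (latticeBasis d))) (v : EuclideanSpace ℝ (Fin d)) :
    f (g + v) = f v := by
  induction hg using Submodule.span_induction generalizing v with
  | mem x hx =>
    obtain ⟨j, rfl⟩ := hx
    rw [latticeBasis_apply, add_comm, hf]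
  | zero => simp
  | add x y _ _ hx hy => rw [add_assoc, hx, hy]
  | smul a x _ hx =>
    induction a using Int.induction_on generalizing v with
    | zero => simp
    | succ n ih => rw [add_smul, one_smul, add_assoc, ih, hx]
    | pred n ih =>
      rw [sub_smul, one_smul, ← hx (((-(n : ℤ)) • x - x) + v)]
      rw [show x + (((-(n : ℤ)) • x - x) + v) = (-(n : ℤ)) • x + v by abel, ih]

instance countable_periodLattice (d : ℕ) :
    Countable (Submodule.span ℤ (Set.range (latticeBasis d))).toAddSubgroup :=
  inferInstanceAs (Countable (Submodule.span ℤ (Set.range (latticeBasis d))))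

/-- The half-open velocity cube. -/
def halfCube (d : ℕ) : Set (EuclideanSpace ℝ (Fin d)) :=
  {v | ∀ j, v j ∈ Set.Ico (-Real.pi) Real.pi}

lemma halfCube_eq_vadd (d : ℕ) :
    halfCube d = (WithLp.toLp 2 fun _ => -Real.pi : EuclideanSpace ℝ (Fin d)) +ᵥ
      ZSpan.fundamentalDomain (latticeBasis d) := by
  have hpi := Real.pi_pos
  ext v
  rw [Set.mem_vadd_set_iff_neg_vadd_mem, ZSpan.mem_fundamentalDomain]
  refine forall_congr' fun j => ?_
  rw [latticeBasis_repr]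
  simp only [vadd_eq_add, PiLp.add_apply, PiLp.neg_apply, neg_neg, Set.mem_Ico]
  rw [← div_eq_inv_mul, le_div_iff₀ (by positivity), div_lt_iff₀ (by positivity)]
  constructor <;> rintro ⟨h1, h2⟩ <;> constructor <;> linarith

/-- Having this for every translate `x` is what makes integrals of periodic functions translation
invariant: any two fundamental domains of the same lattice give the same integral. -/
lemma isAddFundamentalDomain_halfCube (x : EuclideanSpace ℝ (Fin d)) :
    IsAddFundamentalDomain (Submodule.span ℤ (Set.range (latticeBasis d))).toAddSubgroup (x +ᵥ halfCube d)
      (volume : Measure (EuclideanSpace ℝ (Fin d))) := by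
  rw [halfCube_eq_vadd, vadd_vadd]
  exact (ZSpan.isAddFundamentalDomain' (latticeBasis d) volume).vadd_of_comm _

/-- The two cubes differ by faces of measure zero; the half-open one is a translate of
`ZSpan.fundamentalDomain`. -/
lemma cubeMeasure_eq_halfCube (d : ℕ) : cubeMeasure d = volume.restrict (halfCube d) := by
  refine Measure.restrict_congr_set ?_
  have h := (EuclideanSpace.volume_preserving_symm_measurableEquiv_toLp (Fin d)).quasiMeasurePreserving.preimage_ae_eq
    (Measure.univ_pi_Ico_ae_eq_Icc (μ := fun _ : Fin d => (volume : Measure ℝ))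
      (f := fun _ => -Real.pi) (g := fun _ => Real.pi)).symm
  have e1 : {v : EuclideanSpace ℝ (Fin d) | ∀ j, v j ∈ Set.Icc (-Real.pi) Real.pi} =
      (MeasurableEquiv.toLp 2 (Fin d → ℝ)).symm ⁻¹'
        Set.Icc (fun _ => -Real.pi) (fun _ => Real.pi) := by
    ext v; simp [Pi.le_def, forall_and]
  have e2 : halfCube d = (MeasurableEquiv.toLp 2 (Fin d → ℝ)).symm ⁻¹'
      Set.univ.pi fun _ => Set.Ico (-Real.pi) Real.pi := by
    ext v; simp [halfCube, Set.mem_pi]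
  rw [e1, e2]
  exact h

lemma HasPeriods.lintegral_vadd {f : EuclideanSpace ℝ (Fin d) → ℝ≥0∞} (hf : HasPeriods f)
    (x : EuclideanSpace ℝ (Fin d)) :
    ∫⁻ v in x +ᵥ halfCube d, f v = ∫⁻ v, f v ∂(cubeMeasure d) := by
  rw [cubeMeasure_eq_halfCube]
  have h0 := isAddFundamentalDomain_halfCube (0 : EuclideanSpace ℝ (Fin d))
  rw [zero_vadd] at h0
  exact (isAddFundamentalDomain_halfCube x).setLIntegral_eq h0 f
    fun g v => hf.add_mem g.2 v

lemma HasPeriods.integral_vadd {f : EuclideanSpace ℝ (Fin d) → ℂ} (hf : HasPeriods f)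
    (x : EuclideanSpace ℝ (Fin d)) :
    ∫ v in x +ᵥ halfCube d, f v = ∫ v, f v ∂(cubeMeasure d) := by
  rw [cubeMeasure_eq_halfCube]
  have h0 := isAddFundamentalDomain_halfCube (0 : EuclideanSpace ℝ (Fin d))
  rw [zero_vadd] at h0
  exact (isAddFundamentalDomain_halfCube x).setIntegral_eq h0
    fun g v => hf.add_mem g.2 v

lemma preimage_vadd_halfCube (x : EuclideanSpace ℝ (Fin d)) :
    (fun v => v + x) ⁻¹' (x +ᵥ halfCube d) = halfCube d := by
  ext v
  rw [Set.mem_preimage, Set.mem_vadd_set_iff_neg_vadd_mem]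
  simp

lemma HasPeriods.lintegral_comp_add {f : EuclideanSpace ℝ (Fin d) → ℝ≥0∞} (hf : HasPeriods f)
    (x : EuclideanSpace ℝ (Fin d)) :
    ∫⁻ v, f (v + x) ∂(cubeMeasure d) = ∫⁻ v, f v ∂(cubeMeasure d) := by
  rw [← hf.lintegral_vadd x, cubeMeasure_eq_halfCube]
  nth_rw 1 [← preimage_vadd_halfCube x]
  exact (measurePreserving_add_right volume x).setLIntegral_comp_preimage_emb
    (measurableEmbedding_addRight x) f _

lemma HasPeriods.integral_comp_add {f : EuclideanSpace ℝ (Fin d) → ℂ} (hf : HasPeriods f)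
    (x : EuclideanSpace ℝ (Fin d)) :
    ∫ v, f (v + x) ∂(cubeMeasure d) = ∫ v, f v ∂(cubeMeasure d) := by
  rw [← hf.integral_vadd x, cubeMeasure_eq_halfCube]
  nth_rw 1 [← preimage_vadd_halfCube x]
  exact (measurePreserving_add_right volume x).setIntegral_preimage_emb
    (measurableEmbedding_addRight x) f _

lemma isCompact_cube (d : ℕ) :
    IsCompact {v : EuclideanSpace ℝ (Fin d) | ∀ j, v j ∈ Set.Icc (-Real.pi) Real.pi} := by
  have h := (isCompact_univ_pi fun _ : Fin d => isCompact_Icc (a := -Real.pi) (b := Real.pi)).image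
    (PiLp.continuous_toLp 2 (fun _ : Fin d => ℝ))
  convert h using 1
  ext v
  constructor
  · intro hv
    exact ⟨v.ofLp, by simpa [Pi.le_def, forall_and] using hv, rfl⟩
  · rintro ⟨w, hw, rfl⟩
    simpa [Pi.le_def, forall_and] using hw

instance (d : ℕ) : IsFiniteMeasure (cubeMeasure d) := by
  rw [cubeMeasure]
  exact ⟨by simpa using (isCompact_cube d).measure_lt_top⟩

/-- A bounded set is covered by finitely many translates of the cube, so the integral of a periodic
function over it is controlled by the integral over the cube. -/
lemma exists_lintegral_ball_le (d : ℕ) (ρ : ℝ) :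
    ∃ n : ℕ, ∀ f : EuclideanSpace ℝ (Fin d) → ℝ≥0∞, HasPeriods f →
      ∫⁻ v in Metric.ball 0 ρ, f v ≤ n * ∫⁻ v, f v ∂(cubeMeasure d) := by
  have hpi := Real.pi_pos
  have hcpt : IsCompact (Metric.closedBall (0 : EuclideanSpace ℝ (Fin d)) ρ) :=
    isCompact_closedBall _ _
  have hnhds : ∀ x ∈ Metric.closedBall (0 : EuclideanSpace ℝ (Fin d)) ρ,
      x +ᵥ halfCube d ∈ nhdsWithin x (Metric.closedBall (0 : EuclideanSpace ℝ (Fin d)) ρ) := by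
    intro x _
    -- The cell centred at `x` contains the ball of radius `π` about `x`, since coordinates are
    -- bounded by the norm.
    refine mem_nhdsWithin_of_mem_nhds (Metric.mem_nhds_iff.2 ⟨Real.pi, hpi, fun y hy => ?_⟩)
    rw [Set.mem_vadd_set_iff_neg_vadd_mem]
    intro j
    rw [mem_ball_iff_norm] at hy
    have := (PiLp.norm_apply_le (y - x) j).trans_lt hy
    rw [Real.norm_eq_abs, abs_lt] at this
    have e : (-x +ᵥ y) j = (y - x) j := by simp [vadd_eq_add]; ring
    rw [e]
    exact ⟨this.1.le, this.2⟩
  obtain ⟨t, -, ht⟩ := hcpt.elim_nhdsWithin_subcover _ hnhds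
  refine ⟨t.card, fun f hf => ?_⟩
  calc ∫⁻ v in Metric.ball 0 ρ, f v ≤ ∫⁻ v in ⋃ x ∈ t, x +ᵥ halfCube d, f v :=
        lintegral_mono_set (Metric.ball_subset_closedBall.trans ht)
    _ ≤ ∑ x ∈ t, ∫⁻ v in x +ᵥ halfCube d, f v := by
        clear ht
        induction t using Finset.cons_induction with
        | empty => simp
        | cons a s ha ih =>
          rw [Finset.sum_cons, Finset.cons_eq_insert, Finset.set_biUnion_insert]
          exact (lintegral_union_le _ _ _).trans (by gcongr)
    _ = t.card * ∫⁻ v, f v ∂(cubeMeasure d) := by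
        simp [hf.lintegral_vadd]

/-! ### Fourier modes -/

lemma fourierMode_add (k l : Fin d → ℤ) (v : EuclideanSpace ℝ (Fin d)) :
    fourierMode (k + l) v = fourierMode k v * fourierMode l v := by
  simp only [fourierMode, ← Complex.exp_add, ← mul_add, ← Finset.sum_add_distrib, Pi.add_apply]
  push_cast
  simp only [add_mul]

lemma fourierMode_apply_add (k : Fin d → ℤ) (v w : EuclideanSpace ℝ (Fin d)) :
    fourierMode k (v + w) = fourierMode k v * fourierMode k w := by
  simp only [fourierMode, ← Complex.exp_add, ← mul_add, ← Finset.sum_add_distrib, PiLp.add_apply]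
  push_cast
  simp only [mul_add]

lemma fourierMode_zero : fourierMode (0 : Fin d → ℤ) = 1 := by
  ext v; simp [fourierMode]

lemma norm_fourierMode (k : Fin d → ℤ) (v : EuclideanSpace ℝ (Fin d)) :
    ‖fourierMode k v‖ = 1 := by
  have : Complex.I * ∑ j, (k j : ℂ) * (v j : ℂ) = ((∑ j, (k j : ℝ) * v j : ℝ) : ℂ) * Complex.I := by
    push_cast; ring
  rw [fourierMode, this, Complex.norm_exp_ofReal_mul_I]

lemma contDiff_fourierMode (k : Fin d → ℤ) : ContDiff ℝ ∞ (fourierMode k) := by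
  unfold fourierMode
  refine (contDiff_const.mul (ContDiff.sum fun j _ => contDiff_const.mul ?_)).cexp
  exact Complex.ofRealCLM.contDiff.comp (EuclideanSpace.proj (𝕜 := ℝ) j).contDiff

lemma continuous_fourierMode (k : Fin d → ℤ) : Continuous (fourierMode k) :=
  (contDiff_fourierMode k).continuous

lemma fourierMode_single (k : Fin d → ℤ) (j : Fin d) (t : ℝ) :
    fourierMode k (EuclideanSpace.single j t) = Complex.exp (Complex.I * (k j * t)) := by
  rw [fourierMode, Finset.sum_eq_single j]
  · simp
  · intro i _ hi; simp [hi]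
  · simp

lemma isPeriodic_fourierMode (k : Fin d → ℤ) : IsPeriodic (fourierMode k) := by
  intro j v
  rw [fourierMode_apply_add, fourierMode_single]
  have := Complex.exp_int_mul_two_pi_mul_I (k j)
  rw [show Complex.I * ((k j : ℂ) * ((2 * Real.pi : ℝ) : ℂ)) = (k j : ℂ) * (2 * Real.pi * Complex.I) by
    push_cast; ring, this, mul_one]

lemma memLp_of_continuous {f : EuclideanSpace ℝ (Fin d) → ℂ} (hf : Continuous f) (p : ℝ≥0∞) :
    MemLp f p (cubeMeasure d) := by
  obtain ⟨C, hC⟩ := (isCompact_cube d).exists_bound_of_continuousOn hf.continuousOn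
  refine MemLp.of_bound hf.aestronglyMeasurable C ?_
  rw [cubeMeasure]
  exact (ae_restrict_iff' (isCompact_cube d).measurableSet).2 (.of_forall hC)

/-! ### Transfer to the torus -/

-- Each circle factor carries Haar probability measure, the normalization of the Fourier theory on
-- `UnitAddTorus`.
noncomputable local instance : MeasureSpace UnitAddCircle := ⟨AddCircle.haarAddCircle⟩

local instance : IsProbabilityMeasure (volume : Measure UnitAddCircle) :=
  inferInstanceAs (IsProbabilityMeasure AddCircle.haarAddCircle)

/-- The volume `(2π)^d` of the cube. -/
noncomputable def cubeVol (d : ℕ) : ℝ := (2 * Real.pi) ^ d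

lemma cubeVol_pos (d : ℕ) : 0 < cubeVol d := by unfold cubeVol; positivity

/-- The section of the covering of the torus with values in the cube. -/
noncomputable def torusToCube (d : ℕ) (t : UnitAddTorus (Fin d)) : EuclideanSpace ℝ (Fin d) :=
  (2 * Real.pi) • WithLp.toLp 2 fun i => ((AddCircle.equivIoc 1 (-(1 / 2)) (t i) : ℝ))

/-- The half-open convention opposite to `halfCube`, to match the range of `AddCircle.equivIoc`. -/
lemma cubeMeasure_eq_Ioc (d : ℕ) :
    cubeMeasure d = volume.restrict {v | ∀ j, v j ∈ Set.Ioc (-Real.pi) Real.pi} := by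
  refine Measure.restrict_congr_set ?_
  have h := (EuclideanSpace.volume_preserving_symm_measurableEquiv_toLp (Fin d)).quasiMeasurePreserving.preimage_ae_eq
    (Measure.univ_pi_Ioc_ae_eq_Icc (μ := fun _ : Fin d => (volume : Measure ℝ))
      (f := fun _ => -Real.pi) (g := fun _ => Real.pi)).symm
  have e1 : {v : EuclideanSpace ℝ (Fin d) | ∀ j, v j ∈ Set.Icc (-Real.pi) Real.pi} =
      (MeasurableEquiv.toLp 2 (Fin d → ℝ)).symm ⁻¹'
        Set.Icc (fun _ => -Real.pi) (fun _ => Real.pi) := by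
    ext v; simp [Pi.le_def, forall_and]
  have e2 : {v : EuclideanSpace ℝ (Fin d) | ∀ j, v j ∈ Set.Ioc (-Real.pi) Real.pi} =
      (MeasurableEquiv.toLp 2 (Fin d → ℝ)).symm ⁻¹'
        Set.univ.pi fun _ => Set.Ioc (-Real.pi) Real.pi := by
    ext v; simp [Set.mem_pi]
  rw [e1, e2]
  exact h

lemma measurePreserving_torusToCube (d : ℕ) :
    MeasurePreserving (torusToCube d) volume
      (ENNReal.ofReal (cubeVol d)⁻¹ • cubeMeasure d) := by
  have hpi : 0 < 2 * Real.pi := by positivity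
  set S : Set (Fin d → ℝ) := {x | ∀ i, x i ∈ Set.Ioc (-(1 / 2) : ℝ) (-(1 / 2) + 1)} with hS
  have hSm : MeasurableSet S := MeasurableSet.univ_pi' fun i => measurableSet_Ioc
  have h1 := UnitAddTorus.measurePreserving_equivPiIoc (fun _ : Fin d => (-(1 / 2) : ℝ))
  have h2 : MeasurePreserving (Subtype.val : S → Fin d → ℝ) (Measure.comap Subtype.val volume)
      (volume.restrict S) := measurePreserving_subtype_coe hSm
  have h3 : MeasurePreserving (fun x : Fin d → ℝ => (2 * Real.pi) •
      (WithLp.toLp 2 x : EuclideanSpace ℝ (Fin d)))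
      (volume.restrict S) (ENNReal.ofReal (cubeVol d)⁻¹ • cubeMeasure d) := by
    have ha := EuclideanSpace.volume_preserving_symm_measurableEquiv_toLp (Fin d)
    have hb : MeasurePreserving (fun v : EuclideanSpace ℝ (Fin d) => (2 * Real.pi) • v) volume
        (ENNReal.ofReal (cubeVol d)⁻¹ • volume) := by
      refine ⟨measurable_const_smul _, ?_⟩
      rw [Measure.map_addHaar_smul volume hpi.ne', finrank_euclideanSpace_fin, cubeVol,
        abs_of_pos (by positivity)]
    have hc := hb.comp ha.symm
    have hm : MeasurableSet {v : EuclideanSpace ℝ (Fin d) |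
        ∀ j, v j ∈ Set.Ioc (-Real.pi) Real.pi} := by
      simp only [Set.ofPred_forall]
      exact MeasurableSet.iInter fun j => measurableSet_Ioc.preimage (by fun_prop)
    have hd := hc.restrict_preimage hm
    rw [Measure.restrict_smul, ← cubeMeasure_eq_Ioc] at hd
    have hpre : ((fun v : EuclideanSpace ℝ (Fin d) => (2 * Real.pi) • v) ∘
        (MeasurableEquiv.toLp 2 (Fin d → ℝ)).symm.symm) ⁻¹'
          {v | ∀ j, v j ∈ Set.Ioc (-Real.pi) Real.pi} = S := by
      ext x
      refine forall_congr' fun j => ?_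
      have e : ((fun v : EuclideanSpace ℝ (Fin d) => (2 * Real.pi) • v) ∘
        (MeasurableEquiv.toLp 2 (Fin d → ℝ)).symm.symm) x j = 2 * Real.pi * x j := rfl
      rw [e, Set.mem_Ioc, Set.mem_Ioc]
      constructor <;> rintro ⟨h1, h2⟩ <;> constructor <;> nlinarith [Real.pi_pos]
    rw [hpre] at hd
    exact hd
  exact h3.comp (h2.comp h1)

lemma fourierMode_torusToCube (k : Fin d → ℤ) (t : UnitAddTorus (Fin d)) :
    fourierMode k (torusToCube d t) = UnitAddTorus.mFourier k t := by
  have ht : ∀ i, ((AddCircle.equivIoc 1 (-(1 / 2)) (t i) : ℝ) : UnitAddCircle) = t i := fun i =>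
    (AddCircle.equivIoc 1 (-(1 / 2) : ℝ)).symm_apply_apply (t i)
  rw [fourierMode, Finset.mul_sum, Complex.exp_sum, UnitAddTorus.mFourier]
  refine Finset.prod_congr rfl fun i _ => ?_
  have := fourier_coe_apply (T := 1) (n := k i) (x := (AddCircle.equivIoc 1 (-(1 / 2)) (t i) : ℝ))
  rw [ht] at this
  rw [this]
  congr 1
  simp only [torusToCube, PiLp.smul_apply, smul_eq_mul]
  push_cast
  ring

/-! ### Fourier coefficients -/

/-- The `L²` norm over the cube. -/
noncomputable def l2Norm (f : EuclideanSpace ℝ (Fin d) → ℂ) : ℝ :=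
  (eLpNorm f 2 (cubeMeasure d)).toReal

/-- The Fourier coefficients over the cube. -/
noncomputable def fourierCoef (f : EuclideanSpace ℝ (Fin d) → ℂ) (k : Fin d → ℤ) : ℂ :=
  (cubeVol d : ℂ)⁻¹ * ∫ v, f v * fourierMode (-k) v ∂(cubeMeasure d)

lemma sq_l2Norm {f : EuclideanSpace ℝ (Fin d) → ℂ} (hf : MemLp f 2 (cubeMeasure d)) :
    l2Norm f ^ 2 = ∫ v, ‖f v‖ ^ 2 ∂(cubeMeasure d) := by
  rw [l2Norm, hf.eLpNorm_eq_integral_rpow_norm (by simp) (by simp), ENNReal.toReal_ofReal (by positivity)]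
  simp only [ENNReal.toReal_ofNat, Real.rpow_ofNat]
  rw [← Real.rpow_natCast, ← Real.rpow_mul (integral_nonneg fun _ => by positivity)]
  norm_num

/-- Parseval's identity, pulled back to the unit torus along `torusToCube`; the factor `cubeVol d`
undoes the normalization of the torus to mass one. -/
lemma hasSum_sq_fourierCoef {f : EuclideanSpace ℝ (Fin d) → ℂ} (hf : MemLp f 2 (cubeMeasure d)) :
    HasSum (fun k => cubeVol d * ‖fourierCoef f k‖ ^ 2) (l2Norm f ^ 2) := by
  have hV := cubeVol_pos d
  have hmp := measurePreserving_torusToCube d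
  have hf' : MemLp f 2 (ENNReal.ofReal (cubeVol d)⁻¹ • cubeMeasure d) :=
    hf.smul_measure ENNReal.ofReal_ne_top
  have hτ : MemLp (f ∘ torusToCube d) 2 volume := hf'.comp_measurePreserving hmp
  have key : ∀ {G : Type} [NormedAddCommGroup G] [NormedSpace ℝ G] (g : EuclideanSpace ℝ (Fin d) → G),
      AEStronglyMeasurable g (cubeMeasure d) →
      ∫ t, g (torusToCube d t) = (cubeVol d)⁻¹ • ∫ v, g v ∂(cubeMeasure d) := by
    intro G _ _ g hg
    rw [← integral_map hmp.measurable.aemeasurable, hmp.map_eq, integral_smul_measure,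
      ENNReal.toReal_ofReal (by positivity)]
    rw [hmp.map_eq]
    exact hg.smul_measure _
  have h := UnitAddTorus.hasSum_sq_mFourierCoeff hτ.toLp
  have hcoe := hτ.coeFn_toLp
  have h1 : ∀ k, UnitAddTorus.mFourierCoeff (hτ.toLp) k = fourierCoef f k := by
    intro k
    rw [UnitAddTorus.mFourierCoeff, fourierCoef]
    have : ∫ t, UnitAddTorus.mFourier (-k) t • (hτ.toLp) t =
        ∫ t, (fun v => f v * fourierMode (-k) v) (torusToCube d t) := by
      refine integral_congr_ae ?_
      filter_upwards [hcoe] with t ht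
      rw [ht, smul_eq_mul, fourierMode_torusToCube, mul_comm]; rfl
    rw [this, key (fun v => f v * fourierMode (-k) v) (hf.1.mul (continuous_fourierMode _).aestronglyMeasurable)]
    simp
  have h2 : ∫ t, ‖(hτ.toLp) t‖ ^ 2 = (cubeVol d)⁻¹ * l2Norm f ^ 2 := by
    rw [sq_l2Norm hf, ← smul_eq_mul, ← key (fun v => ‖f v‖ ^ 2) (hf.1.norm.pow 2)]
    refine integral_congr_ae ?_
    filter_upwards [hcoe] with t ht
    rw [ht]; rfl
  simp only [h1, h2] at h
  have := h.mul_left (cubeVol d)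
  rwa [← mul_assoc, mul_inv_cancel₀ hV.ne', one_mul] at this

lemma measureReal_cube (d : ℕ) : (cubeMeasure d).real Set.univ = cubeVol d := by
  have h := (measurePreserving_torusToCube d).measureReal_preimage (s := Set.univ)
    MeasurableSet.univ.nullMeasurableSet
  rw [Set.preimage_univ, probReal_univ, measureReal_ennreal_smul_apply,
    ENNReal.toReal_ofReal (inv_nonneg.2 (cubeVol_pos d).le)] at h
  have hV := (cubeVol_pos d).ne'
  field_simp at h
  exact h.symm

/-- If `k j ≠ 0`, translation by `π / k j` along `e_j` preserves the integral and multiplies the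
mode by `-1`. -/
lemma integral_fourierMode (k : Fin d → ℤ) :
    ∫ v, fourierMode k v ∂(cubeMeasure d) = if k = 0 then (cubeVol d : ℂ) else 0 := by
  split_ifs with hk
  · rw [hk, fourierMode_zero]
    simp [measureReal_cube]
  · obtain ⟨j, hj⟩ := Function.ne_iff.1 hk
    have hj' : (k j : ℝ) ≠ 0 := by exact_mod_cast hj
    have hper : HasPeriods (fourierMode k) := isPeriodic_fourierMode k
    have h := hper.integral_comp_add (EuclideanSpace.single j (Real.pi / k j))
    simp only [fourierMode_apply_add, integral_mul_const] at h
    rw [fourierMode_single] at h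
    have : Complex.I * ((k j : ℂ) * ((Real.pi / k j : ℝ) : ℂ)) = Real.pi * Complex.I := by
      have hj'' : (k j : ℂ) ≠ 0 := by exact_mod_cast hj
      push_cast; field_simp
    rw [this, Complex.exp_pi_mul_I] at h
    linear_combination (-1 / 2 : ℂ) * h

lemma fourierCoef_fourierMode (m k : Fin d → ℤ) :
    fourierCoef (fourierMode m) k = if m = k then 1 else 0 := by
  have hV : (cubeVol d : ℂ) ≠ 0 := by exact_mod_cast (cubeVol_pos d).ne'
  simp only [fourierCoef, ← fourierMode_add, integral_fourierMode, ← sub_eq_add_neg, sub_eq_zero]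
  split_ifs <;> simp [hV]

lemma integrable_mul_fourierMode {f : EuclideanSpace ℝ (Fin d) → ℂ}
    (hf : MemLp f 2 (cubeMeasure d)) (k : Fin d → ℤ) :
    Integrable (fun v => f v * fourierMode k v) (cubeMeasure d) :=
  (hf.integrable (by norm_num)).mul_bdd (c := 1) (continuous_fourierMode k).aestronglyMeasurable
    (.of_forall fun v => (norm_fourierMode k v).le)

lemma fourierCoef_sub {f g : EuclideanSpace ℝ (Fin d) → ℂ} (hf : MemLp f 2 (cubeMeasure d))
    (hg : MemLp g 2 (cubeMeasure d)) (k : Fin d → ℤ) :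
    fourierCoef (f - g) k = fourierCoef f k - fourierCoef g k := by
  simp only [fourierCoef, Pi.sub_apply, sub_mul]
  rw [integral_sub (integrable_mul_fourierMode hf _) (integrable_mul_fourierMode hg _), mul_sub]

lemma fourierCoef_sum {ι : Type*} (s : Finset ι) (c : ι → ℂ) (m : ι → Fin d → ℤ)
    (k : Fin d → ℤ) :
    fourierCoef (∑ i ∈ s, c i • fourierMode (m i)) k = ∑ i ∈ s, if m i = k then c i else 0 := by
  simp only [fourierCoef, Finset.sum_apply, Finset.sum_mul, Pi.smul_apply, smul_eq_mul, mul_assoc]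
  rw [integral_finsetSum, Finset.mul_sum]
  · refine Finset.sum_congr rfl fun i _ => ?_
    have := fourierCoef_fourierMode (m i) k
    rw [fourierCoef] at this
    rw [integral_const_mul, mul_left_comm, this]
    simp
  · intro i _
    exact (integrable_mul_fourierMode (memLp_of_continuous (continuous_fourierMode _) 2) _).const_mul _

/-- The frequencies of `ℙ^N`. -/
noncomputable def freqBox (d N : ℕ) : Finset (Fin d → ℤ) :=
  Fintype.piFinset fun _ => Finset.Icc (-(N : ℤ)) N

lemma mem_freqBox {N : ℕ} {k : Fin d → ℤ} :
    k ∈ freqBox d N ↔ ∀ j, -(N : ℤ) ≤ k j ∧ k j ≤ N := by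
  simp [freqBox]

/-- The `L²`-orthogonal projection onto `ℙ^N`. -/
noncomputable def fourierProj (N : ℕ) (f : EuclideanSpace ℝ (Fin d) → ℂ) :
    EuclideanSpace ℝ (Fin d) → ℂ :=
  ∑ k ∈ freqBox d N, fourierCoef f k • fourierMode k

lemma fourierProj_mem (N : ℕ) (f : EuclideanSpace ℝ (Fin d) → ℂ) :
    fourierProj N f ∈ trigPoly d N :=
  Submodule.sum_mem _ fun k hk => Submodule.smul_mem _ _ <|
    Submodule.subset_span ⟨k, mem_freqBox.1 hk, rfl⟩

lemma mem_trigPoly_iff {N : ℕ} {p : EuclideanSpace ℝ (Fin d) → ℂ} :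
    p ∈ trigPoly d N ↔ ∃ c : (Fin d → ℤ) → ℂ, p = ∑ k ∈ freqBox d N, c k • fourierMode k := by
  constructor
  · intro hp
    induction hp using Submodule.span_induction with
    | mem x hx =>
      obtain ⟨k, hk, rfl⟩ := hx
      refine ⟨Pi.single k 1, ?_⟩
      rw [Finset.sum_eq_single k]
      · simp
      · intro l _ hl; simp [hl]
      · intro h; exact absurd (mem_freqBox.2 hk) h
    | zero => exact ⟨0, by simp⟩
    | add x y _ _ hx hy =>
      obtain ⟨a, rfl⟩ := hx
      obtain ⟨b, rfl⟩ := hy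
      exact ⟨a + b, by simp [add_smul, Finset.sum_add_distrib]⟩
    | smul c x _ hx =>
      obtain ⟨a, rfl⟩ := hx
      exact ⟨c • a, by simp [Finset.smul_sum, mul_smul]⟩
  · rintro ⟨c, rfl⟩
    exact Submodule.sum_mem _ fun k hk => Submodule.smul_mem _ _ <|
      Submodule.subset_span ⟨k, mem_freqBox.1 hk, rfl⟩

lemma continuous_of_mem_trigPoly {N : ℕ} {p : EuclideanSpace ℝ (Fin d) → ℂ}
    (hp : p ∈ trigPoly d N) : Continuous p := by
  obtain ⟨c, rfl⟩ := mem_trigPoly_iff.1 hp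
  have h : ∀ k ∈ freqBox d N, Continuous (c k • fourierMode k) := fun k _ =>
    (continuous_fourierMode k).const_smul (c k)
  simpa [Finset.sum_fn] using continuous_finsetSum _ h

lemma isPeriodic_of_mem_trigPoly {N : ℕ} {p : EuclideanSpace ℝ (Fin d) → ℂ}
    (hp : p ∈ trigPoly d N) : IsPeriodic p := by
  obtain ⟨c, rfl⟩ := mem_trigPoly_iff.1 hp
  intro j v
  simp only [Finset.sum_apply, Pi.smul_apply, isPeriodic_fourierMode _ j v]

lemma memLp_of_mem_trigPoly {N : ℕ} {p : EuclideanSpace ℝ (Fin d) → ℂ}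
    (hp : p ∈ trigPoly d N) : MemLp p 2 (cubeMeasure d) :=
  memLp_of_continuous (continuous_of_mem_trigPoly hp) 2

lemma trigPoly_mono {M N : ℕ} (h : M ≤ N) : trigPoly d M ≤ trigPoly d N := by
  refine Submodule.span_mono (Set.image_mono fun k hk j => ?_)
  have := hk j
  constructor <;> [have := this.1; have := this.2] <;> omega

lemma fourierCoef_eq_zero_of_ae {f : EuclideanSpace ℝ (Fin d) → ℂ}
    (hf : f =ᵐ[cubeMeasure d] 0) (k : Fin d → ℤ) : fourierCoef f k = 0 := by
  rw [fourierCoef, integral_congr_ae (g := 0), Pi.zero_def, integral_zero, mul_zero]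
  filter_upwards [hf] with v hv
  simp [hv]

/-- A trigonometric polynomial that vanishes almost everywhere on the cube vanishes. -/
lemma eq_zero_of_mem_trigPoly {N : ℕ} {p : EuclideanSpace ℝ (Fin d) → ℂ}
    (hp : p ∈ trigPoly d N) (h : p =ᵐ[cubeMeasure d] 0) : p = 0 := by
  obtain ⟨c, rfl⟩ := mem_trigPoly_iff.1 hp
  refine Finset.sum_eq_zero fun k hk => ?_
  have := fourierCoef_eq_zero_of_ae h k
  rw [fourierCoef_sum, Finset.sum_ite_eq' _ k, if_pos hk] at this
  rw [this, zero_smul]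

/-- Parseval for the remainder: its coefficients cancel inside the box and equal those of `f`
outside. -/
lemma hasSum_sq_sub_fourierProj {f : EuclideanSpace ℝ (Fin d) → ℂ}
    (hf : MemLp f 2 (cubeMeasure d)) (N : ℕ) :
    HasSum (fun k => if k ∈ freqBox d N then 0 else cubeVol d * ‖fourierCoef f k‖ ^ 2)
      (l2Norm (f - fourierProj N f) ^ 2) := by
  have hP := memLp_of_mem_trigPoly (fourierProj_mem N f)
  convert hasSum_sq_fourierCoef (hf.sub hP) using 2 with k
  rw [fourierCoef_sub hf hP, fourierProj, fourierCoef_sum, Finset.sum_ite_eq']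
  split_ifs <;> simp

/-! ### Integration by parts over a period -/

lemma contDiff_partialDeriv {φ : EuclideanSpace ℝ (Fin d) → ℂ} (hφ : ContDiff ℝ ∞ φ)
    (j : Fin d) : ContDiff ℝ ∞ (partialDeriv j φ) :=
  (hφ.fderiv_right (m := ∞) (by simp)).clm_apply contDiff_const

lemma isPeriodic_partialDeriv {φ : EuclideanSpace ℝ (Fin d) → ℂ} (hφ : IsPeriodic φ)
    (j : Fin d) : IsPeriodic (partialDeriv j φ) := by
  intro i v
  have h : (fun w => φ (w + EuclideanSpace.single i (2 * Real.pi))) = φ := funext (hφ i)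
  rw [partialDeriv, ← fderiv_comp_add_right, h, partialDeriv]

/-- Averaging over translations by `t e_j`, `0 < t ≤ 2π`, does not change the integral. After
exchanging the order of integration, each line integral vanishes by the fundamental theorem of
calculus and periodicity. -/
lemma integral_partialDeriv {φ : EuclideanSpace ℝ (Fin d) → ℂ} (hφ : ContDiff ℝ ∞ φ)
    (hper : IsPeriodic φ) (j : Fin d) :
    ∫ v, partialDeriv j φ v ∂(cubeMeasure d) = 0 := by
  have hpi := Real.pi_pos
  set e : EuclideanSpace ℝ (Fin d) := EuclideanSpace.single j 1 with he
  have hc : Continuous (partialDeriv j φ) := (contDiff_partialDeriv hφ j).continuous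
  have hP : HasPeriods (partialDeriv j φ) := isPeriodic_partialDeriv hper j
  have hline : ∀ v, ∫ t in (0 : ℝ)..(2 * Real.pi), partialDeriv j φ (v + t • e) = 0 := by
    intro v
    have hderiv : ∀ t : ℝ, HasDerivAt (fun t : ℝ => φ (v + t • e)) (partialDeriv j φ (v + t • e)) t := by
      intro t
      have h1 : HasDerivAt (fun t : ℝ => v + t • e) e t := by
        simpa using ((hasDerivAt_id t).smul_const e).const_add v
      exact ((hφ.differentiable (by simp)) _).hasFDerivAt.comp_hasDerivAt t h1
    rw [intervalIntegral.integral_eq_sub_of_hasDerivAt (fun t _ => hderiv t)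
      (Continuous.intervalIntegrable (by fun_prop) _ _)]
    have : (2 * Real.pi) • e = EuclideanSpace.single j (2 * Real.pi) := by
      ext i; simp [he]
    rw [this, hper]
    simp
  have hint : Integrable (Function.uncurry fun (t : ℝ) v => partialDeriv j φ (v + t • e))
      ((volume.restrict (Set.Ioc 0 (2 * Real.pi))).prod (cubeMeasure d)) := by
    rw [cubeMeasure, Measure.prod_restrict]
    have hcont : Continuous (Function.uncurry fun (t : ℝ) v => partialDeriv j φ (v + t • e)) := by
      unfold Function.uncurry; fun_prop
    exact (hcont.continuousOn.integrableOn_compact (isCompact_Icc.prod (isCompact_cube d))).mono_set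
      (Set.prod_mono Set.Ioc_subset_Icc_self le_rfl)
  have hswap := integral_integral_swap hint
  have h1 : ∀ t : ℝ, ∫ v, partialDeriv j φ (v + t • e) ∂(cubeMeasure d) =
      ∫ v, partialDeriv j φ v ∂(cubeMeasure d) := fun t => hP.integral_comp_add _
  simp only [h1, ← intervalIntegral.integral_of_le (by positivity : (0 : ℝ) ≤ 2 * Real.pi),
    hline] at hswap
  simpa [hpi.ne'] using hswap

lemma partialDeriv_fourierMode (k : Fin d → ℤ) (j : Fin d) :
    partialDeriv j (fourierMode k) = (Complex.I * k j) • fourierMode k := by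
  ext v
  have h1 : HasFDerivAt (fun v : EuclideanSpace ℝ (Fin d) => Complex.I * ∑ i, (k i : ℂ) * (v i : ℂ))
      (Complex.I • ∑ i, (k i : ℂ) • (Complex.ofRealCLM.comp (EuclideanSpace.proj (𝕜 := ℝ) i))) v := by
    refine HasFDerivAt.const_mul (HasFDerivAt.fun_sum fun i _ => HasFDerivAt.const_mul ?_ _) _
    exact (Complex.ofRealCLM.comp
      (EuclideanSpace.proj (𝕜 := ℝ) i : EuclideanSpace ℝ (Fin d) →L[ℝ] ℝ)).hasFDerivAt
  have h2 : HasFDerivAt (fourierMode k) _ v := h1.cexp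
  rw [partialDeriv, h2.fderiv]
  simp only [fourierMode, smul_apply, sum_apply, ContinuousLinearMap.comp_apply,
    Complex.ofRealCLM_apply, PiLp.proj_apply, PiLp.single_apply, smul_eq_mul, Pi.smul_apply]
  have hs : ∑ i, (k i : ℂ) * ((if i = j then 1 else 0 : ℝ) : ℂ) = k j := by
    rw [Finset.sum_eq_single j (by intro i _ hi; simp [hi]) (by simp)]
    simp
  rw [hs]
  ring

lemma integrable_fourierMode_mul {g : EuclideanSpace ℝ (Fin d) → ℂ} (hg : Continuous g)
    (k : Fin d → ℤ) : Integrable (fun v => fourierMode k v * g v) (cubeMeasure d) :=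
  memLp_one_iff_integrable.1 (memLp_of_continuous ((continuous_fourierMode k).mul hg) 1)

lemma integral_fourierMode_mul_partialDeriv {φ : EuclideanSpace ℝ (Fin d) → ℂ}
    (hφ : ContDiff ℝ ∞ φ) (hper : IsPeriodic φ) (k : Fin d → ℤ) (j : Fin d) :
    ∫ v, fourierMode k v * partialDeriv j φ v ∂(cubeMeasure d) =
      (-(Complex.I * k j)) * ∫ v, fourierMode k v * φ v ∂(cubeMeasure d) := by
  have hk := contDiff_fourierMode k
  have hmul : partialDeriv j (fun v => fourierMode k v * φ v) = fun v =>
      fourierMode k v * partialDeriv j φ v + (Complex.I * k j) * (fourierMode k v * φ v) := by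
    ext v
    have h := congrFun (partialDeriv_fourierMode k j) v
    rw [partialDeriv] at h
    rw [partialDeriv, fderiv_fun_mul (hk.differentiable (by simp) v) (hφ.differentiable (by simp) v)]
    simp only [add_apply, smul_apply, smul_eq_mul, h,
      Pi.smul_apply, partialDeriv]
    ring
  have h0 := integral_partialDeriv (hk.mul hφ)
    (fun i v => by simp only [isPeriodic_fourierMode k i v, hper i v]) j
  have hc := (contDiff_partialDeriv hφ j).continuous
  rw [hmul, integral_add (integrable_fourierMode_mul hc k)
    ((integrable_fourierMode_mul hφ.continuous k).const_mul _), integral_const_mul] at h0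
  linear_combination h0

lemma contDiff_isPeriodic_iterate_partialDeriv {φ : EuclideanSpace ℝ (Fin d) → ℂ}
    (hφ : ContDiff ℝ ∞ φ ∧ IsPeriodic φ) (j : Fin d) (n : ℕ) :
    ContDiff ℝ ∞ ((partialDeriv j)^[n] φ) ∧ IsPeriodic ((partialDeriv j)^[n] φ) := by
  induction n with
  | zero => exact hφ
  | succ n ih =>
    rw [Function.iterate_succ_apply']
    exact ⟨contDiff_partialDeriv ih.1 j, isPeriodic_partialDeriv ih.2 j⟩

/-- The symbol `(i k)^α` of `∂^α`. -/
noncomputable def derivSymbol (α : Fin d → ℕ) (k : Fin d → ℤ) : ℂ := ∏ j, (Complex.I * k j) ^ α j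

lemma integral_fourierMode_mul_mixedPartial {φ : EuclideanSpace ℝ (Fin d) → ℂ}
    (hφ : ContDiff ℝ ∞ φ) (hper : IsPeriodic φ) (k : Fin d → ℤ) (α : Fin d → ℕ) :
    ∫ v, fourierMode k v * mixedPartial α φ v ∂(cubeMeasure d) =
      (-1) ^ (∑ j, α j) * (derivSymbol α k * ∫ v, fourierMode k v * φ v ∂(cubeMeasure d)) := by
  have hit : ∀ (j : Fin d) (n : ℕ) (ψ : EuclideanSpace ℝ (Fin d) → ℂ),
      ContDiff ℝ ∞ ψ ∧ IsPeriodic ψ →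
      ∫ v, fourierMode k v * (partialDeriv j)^[n] ψ v ∂(cubeMeasure d) =
        (-(Complex.I * k j)) ^ n * ∫ v, fourierMode k v * ψ v ∂(cubeMeasure d) := by
    intro j n ψ hψ
    induction n with
    | zero => simp
    | succ n ih =>
      have h := contDiff_isPeriodic_iterate_partialDeriv hψ j n
      rw [Function.iterate_succ_apply', integral_fourierMode_mul_partialDeriv h.1 h.2, ih]
      ring
  have hfold : ∀ l : List (Fin d),
      (ContDiff ℝ ∞ (l.foldr (fun j g => (partialDeriv j)^[α j] g) φ) ∧
        IsPeriodic (l.foldr (fun j g => (partialDeriv j)^[α j] g) φ)) ∧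
      ∫ v, fourierMode k v * (l.foldr (fun j g => (partialDeriv j)^[α j] g) φ) v ∂(cubeMeasure d) =
        (l.map fun j => (-(Complex.I * k j)) ^ α j).prod *
          ∫ v, fourierMode k v * φ v ∂(cubeMeasure d) := by
    intro l
    induction l with
    | nil => exact ⟨⟨hφ, hper⟩, by simp⟩
    | cons j l ih =>
      refine ⟨contDiff_isPeriodic_iterate_partialDeriv ih.1 j _, ?_⟩
      rw [List.foldr_cons, hit j _ _ ih.1, ih.2, List.map_cons, List.prod_cons, mul_assoc]
  rw [mixedPartial, (hfold _).2, ← mul_assoc]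
  congr 1
  rw [← Fin.prod_univ_def, derivSymbol, ← Finset.prod_pow_eq_pow_sum, ← Finset.prod_mul_distrib]
  exact Finset.prod_congr rfl fun j _ => by rw [← mul_pow]; ring

/-! ### Weak derivatives and Fourier coefficients -/

lemma mixedPartial_fourierMode (α : Fin d → ℕ) (k : Fin d → ℤ) :
    mixedPartial α (fourierMode k) = derivSymbol α k • fourierMode k := by
  have hsmul : ∀ (j : Fin d) (c : ℂ), partialDeriv j (c • fourierMode k) =
      (c * (Complex.I * k j)) • fourierMode k := by
    intro j c
    rw [mul_smul, ← partialDeriv_fourierMode]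
    ext v
    rw [partialDeriv, fderiv_const_smul ((contDiff_fourierMode k).differentiable (by simp) v)]
    rfl
  have hit : ∀ (j : Fin d) (n : ℕ) (c : ℂ), (partialDeriv j)^[n] (c • fourierMode k) =
      ((Complex.I * k j) ^ n * c) • fourierMode k := by
    intro j n c
    induction n with
    | zero => simp
    | succ n ih => rw [Function.iterate_succ_apply', ih, hsmul]; congr 1; ring
  have hfold : ∀ l : List (Fin d),
      l.foldr (fun j g => (partialDeriv j)^[α j] g) (fourierMode k) =
        (l.map fun j => (Complex.I * k j) ^ α j).prod • fourierMode k := by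
    intro l
    induction l with
    | nil => simp
    | cons j l ih => rw [List.foldr_cons, ih, hit, List.map_cons, List.prod_cons]
  rw [mixedPartial, hfold, ← Fin.prod_univ_def, derivSymbol]

/-- Test the weak derivative against the mode `-k`; the sign from `(-ik)^α` cancels the sign of the
integration by parts. In particular the coefficients of a weak derivative do not depend on its
choice. -/
lemma IsWeakDeriv.fourierCoef_eq {α : Fin d → ℕ} {f g : EuclideanSpace ℝ (Fin d) → ℂ}
    (h : IsWeakDeriv α f g) (k : Fin d → ℤ) :
    fourierCoef g k = derivSymbol α k * fourierCoef f k := by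
  have h1 := h.2 _ (contDiff_fourierMode (-k)) (isPeriodic_fourierMode (-k))
  have hs : derivSymbol α (-k) = (-1) ^ (∑ j, α j) * derivSymbol α k := by
    rw [derivSymbol, derivSymbol, ← Finset.prod_pow_eq_pow_sum, ← Finset.prod_mul_distrib]
    exact Finset.prod_congr rfl fun j _ => by rw [← mul_pow]; push_cast [Pi.neg_apply]; ring
  have hsq : ((-1 : ℂ) ^ (∑ j, α j)) * (-1) ^ (∑ j, α j) = 1 := by
    rw [← mul_pow]; simp
  have hcomm : ∀ v, f v * mixedPartial α (fourierMode (-k)) v =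
      derivSymbol α (-k) * (f v * fourierMode (-k) v) := fun v => by
    rw [mixedPartial_fourierMode, Pi.smul_apply, smul_eq_mul, mul_left_comm]
  simp only [hcomm] at h1
  rw [integral_const_mul, hs] at h1
  rw [fourierCoef, fourierCoef]
  linear_combination (cubeVol d : ℂ)⁻¹ * (-1) ^ (∑ j, α j) * (-h1) +
    (cubeVol d : ℂ)⁻¹ * (derivSymbol α k * (∫ v, f v * fourierMode (-k) v ∂(cubeMeasure d)) -
      ∫ v, g v * fourierMode (-k) v ∂(cubeMeasure d)) * hsq

lemma isWeakDeriv_weakDeriv {α : Fin d → ℕ} {f : EuclideanSpace ℝ (Fin d) → ℂ}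
    (h : ∃ g, IsWeakDeriv α f g) : IsWeakDeriv α f (weakDeriv α f) := by
  rw [weakDeriv, dif_pos h]
  exact h.choose_spec

lemma MemHrp.hasSum_sq_weakDeriv {r : ℕ} {f : EuclideanSpace ℝ (Fin d) → ℂ} (hf : MemHrp r f)
    {α : Fin d → ℕ} (hα : ∑ j, α j ≤ r) :
    HasSum (fun k => cubeVol d * ‖derivSymbol α k * fourierCoef f k‖ ^ 2)
      (l2Norm (weakDeriv α f) ^ 2) := by
  have hw := isWeakDeriv_weakDeriv (hf.2.2 α hα)
  simpa only [hw.fourierCoef_eq] using hasSum_sq_fourierCoef hw.1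

lemma l2Norm_nonneg (f : EuclideanSpace ℝ (Fin d) → ℂ) : 0 ≤ l2Norm f := ENNReal.toReal_nonneg

lemma hrpNorm_nonneg (r : ℕ) (f : EuclideanSpace ℝ (Fin d) → ℂ) : 0 ≤ hrpNorm r f :=
  Real.sqrt_nonneg _

lemma l2Norm_weakDeriv_le {r : ℕ} (f : EuclideanSpace ℝ (Fin d) → ℂ) {α : Fin d → ℕ}
    (hα : ∑ j, α j ≤ r) : l2Norm (weakDeriv α f) ≤ hrpNorm r f := by
  refine Real.le_sqrt_of_sq_le ?_
  refine Finset.single_le_sum (f := fun α => (eLpNorm (weakDeriv α f) 2 (cubeMeasure d)).toReal ^ 2)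
    (fun _ _ => by positivity) ?_
  simp only [multiIndices, Finset.mem_filter, Fintype.mem_piFinset, Finset.mem_range]
  refine ⟨fun j => ?_, hα⟩
  have := Finset.single_le_sum (f := α) (fun _ _ => Nat.zero_le _) (Finset.mem_univ j)
  omega

/-- The term `α = 0` of the Sobolev norm involves a chosen weak derivative of order zero, not
literally `f`; Parseval identifies the two norms. -/
lemma MemHrp.l2Norm_le {r : ℕ} {f : EuclideanSpace ℝ (Fin d) → ℂ} (hf : MemHrp r f) :
    l2Norm f ≤ hrpNorm r f := by
  have h := hf.hasSum_sq_weakDeriv (α := 0) (by simp)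
  simp only [derivSymbol, Pi.zero_apply, pow_zero, Finset.prod_const_one, one_mul] at h
  have h2 := h.unique (hasSum_sq_fourierCoef hf.2.1)
  rw [sq_eq_sq₀ (l2Norm_nonneg _) (l2Norm_nonneg _)] at h2
  exact h2 ▸ l2Norm_weakDeriv_le f (by simp)

/-- Spectral accuracy of the Fourier projection on the periodic Sobolev space. -/
lemma MemHrp.l2Norm_sub_fourierProj_le {r : ℕ} {f : EuclideanSpace ℝ (Fin d) → ℂ}
    (hf : MemHrp r f) {N : ℕ} (hN : 1 ≤ N) :
    l2Norm (f - fourierProj N f) ≤ d / (N : ℝ) ^ r * hrpNorm r f := by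
  have hV := cubeVol_pos d
  have hN0 : (0 : ℝ) < N := by exact_mod_cast hN
  -- The pure derivatives `∂_j^r` suffice: a frequency outside the box has some `|k j| > N`, so the
  -- symbol of `∂_j^r` is at least `N^r` there.
  have hα : ∀ j : Fin d, ∑ i, (Pi.single j r : Fin d → ℕ) i ≤ r := fun j => by simp
  have hsum : HasSum (fun k => ((N : ℝ) ^ (2 * r))⁻¹ * ∑ j : Fin d,
      cubeVol d * ‖derivSymbol (Pi.single j r) k * fourierCoef f k‖ ^ 2)
      (((N : ℝ) ^ (2 * r))⁻¹ * ∑ j : Fin d, l2Norm (weakDeriv (Pi.single j r) f) ^ 2) :=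
    (hasSum_sum fun j _ => hf.hasSum_sq_weakDeriv (hα j)).mul_left _
  have hle := hasSum_le (fun k => ?_) (hasSum_sq_sub_fourierProj hf.2.1 N) hsum
  · have h2 : l2Norm (f - fourierProj N f) ^ 2 ≤ (d / (N : ℝ) ^ r * hrpNorm r f) ^ 2 := by
      refine hle.trans ?_
      have h3 : ∑ j : Fin d, l2Norm (weakDeriv (Pi.single j r) f) ^ 2 ≤ d * hrpNorm r f ^ 2 := by
        refine (Finset.sum_le_card_nsmul _ _ (hrpNorm r f ^ 2) fun j _ => ?_).trans (by simp)
        exact pow_le_pow_left₀ (l2Norm_nonneg _) (l2Norm_weakDeriv_le f (hα j)) 2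
      -- The sum over `j` yields the constant `√d`; this trades it for the simpler `d`.
      have hd : (d : ℝ) ≤ d ^ 2 := by exact_mod_cast Nat.le_self_pow (by norm_num) d
      calc ((N : ℝ) ^ (2 * r))⁻¹ * ∑ j : Fin d, l2Norm (weakDeriv (Pi.single j r) f) ^ 2
          ≤ ((N : ℝ) ^ (2 * r))⁻¹ * (d ^ 2 * hrpNorm r f ^ 2) := by
            gcongr
            exact h3.trans (by gcongr)
        _ = _ := by rw [mul_pow, div_pow, ← pow_mul, mul_comm r 2]; ring
    exact (sq_le_sq₀ (l2Norm_nonneg _) (by have := hrpNorm_nonneg r f; positivity)).1 h2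
  · split_ifs with hk
    · positivity
    · rw [mem_freqBox, not_forall] at hk
      obtain ⟨j, hj⟩ := hk
      have habs : (N : ℝ) ≤ ‖(k j : ℂ)‖ := by
        rw [Complex.norm_intCast]
        have : (N : ℤ) ≤ |k j| := by
          rw [le_abs]; omega
        exact_mod_cast this
      have hs : ‖derivSymbol (Pi.single j r) k‖ = ‖(k j : ℂ)‖ ^ r := by
        rw [derivSymbol, Finset.prod_eq_single j]
        · simp
        · intro i _ hi; simp [hi]
        · simp
      have h1 : cubeVol d * ‖fourierCoef f k‖ ^ 2 ≤ ((N : ℝ) ^ (2 * r))⁻¹ *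
          (cubeVol d * ‖derivSymbol (Pi.single j r) k * fourierCoef f k‖ ^ 2) := by
        rw [inv_mul_eq_div, le_div_iff₀ (by positivity), norm_mul, hs]
        have : (N : ℝ) ^ (2 * r) ≤ (‖(k j : ℂ)‖ ^ r) ^ 2 := by
          rw [← pow_mul, mul_comm r 2]; gcongr
        calc _ = cubeVol d * (‖fourierCoef f k‖ ^ 2 * (N : ℝ) ^ (2 * r)) := by ring
          _ ≤ cubeVol d * (‖fourierCoef f k‖ ^ 2 * (‖(k j : ℂ)‖ ^ r) ^ 2) := by gcongr
          _ = _ := by ring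
      refine h1.trans ?_
      gcongr
      exact Finset.single_le_sum (f := fun j => cubeVol d *
        ‖derivSymbol (Pi.single j r) k * fourierCoef f k‖ ^ 2) (fun _ _ => by positivity)
        (Finset.mem_univ j)

/-! ### Trigonometric polynomials belong to every Sobolev space -/

lemma exists_isWeakDeriv_of_mem_trigPoly {N : ℕ} {p : EuclideanSpace ℝ (Fin d) → ℂ}
    (hp : p ∈ trigPoly d N) (α : Fin d → ℕ) : ∃ g, IsWeakDeriv α p g := by
  obtain ⟨c, rfl⟩ := mem_trigPoly_iff.1 hp
  refine ⟨∑ k ∈ freqBox d N, (c k * derivSymbol α k) • fourierMode k,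
    memLp_of_mem_trigPoly (N := N) (mem_trigPoly_iff.2 ⟨_, rfl⟩), fun φ hφ hper => ?_⟩
  have hα : Continuous (mixedPartial α φ) := by
    have : ∀ l : List (Fin d), ContDiff ℝ ∞ (l.foldr (fun j g => (partialDeriv j)^[α j] g) φ) ∧
        IsPeriodic (l.foldr (fun j g => (partialDeriv j)^[α j] g) φ) := by
      intro l
      induction l with
      | nil => exact ⟨hφ, hper⟩
      | cons j l ih => exact contDiff_isPeriodic_iterate_partialDeriv ih j _
    exact (this _).1.continuous
  simp only [Finset.sum_apply, Pi.smul_apply, smul_eq_mul, Finset.sum_mul, mul_assoc]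
  rw [integral_finsetSum _ fun k _ => (integrable_fourierMode_mul hα k).const_mul _,
    integral_finsetSum _ fun k _ =>
      ((integrable_fourierMode_mul hφ.continuous k).const_mul _).const_mul _,
    Finset.mul_sum]
  refine Finset.sum_congr rfl fun k _ => ?_
  rw [integral_const_mul, integral_fourierMode_mul_mixedPartial hφ hper, integral_const_mul,
    integral_const_mul]
  ring

lemma memHrp_of_mem_trigPoly {N : ℕ} {p : EuclideanSpace ℝ (Fin d) → ℂ}
    (hp : p ∈ trigPoly d N) (r : ℕ) : MemHrp r p :=
  ⟨isPeriodic_of_mem_trigPoly hp, memLp_of_mem_trigPoly hp,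
    fun α _ => exists_isWeakDeriv_of_mem_trigPoly hp α⟩

/-! ### The geometry of collisions -/

/-- The velocity change `q/2 + ε |q| σ/2` in a collision; `ε = ±1` distinguishes the two
particles. -/
noncomputable def deflection (ε : ℝ) (q σ : EuclideanSpace ℝ (Fin d)) :
    EuclideanSpace ℝ (Fin d) :=
  (1 / 2 : ℝ) • q + (ε * (‖q‖ / 2)) • σ

/-- Let `x`, `y` be the images of `q`, `p`. As `q = 2x - |q|τ` and `p = 2y - |p|τ`, it is enough to
bound `|q| - |p|`. The identity `|x|² = |q|⟨x,τ⟩`, its analogue for `y`, and `⟨x,τ⟩ ≥ |q|/2` (the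
half-space condition, needed only for the longer vector) give `|q| - |p| ≤ 6|x - y|`, and `8 = 2 +
6`. -/
lemma norm_deflection_sub_ge {τ q p : EuclideanSpace ℝ (Fin d)} (hτ : ‖τ‖ = 1)
    (hq : 0 ≤ ⟪q, τ⟫) (hpq : ‖p‖ ≤ ‖q‖) :
    ‖q - p‖ ≤ 8 * ‖deflection 1 q τ - deflection 1 p τ‖ := by
  set x := deflection 1 q τ with hx
  set y := deflection 1 p τ with hy
  have hττ : ⟪τ, τ⟫ = 1 := by rw [real_inner_self_eq_norm_sq, hτ, one_pow]
  have hinner : ∀ w : EuclideanSpace ℝ (Fin d), ⟪deflection 1 w τ, τ⟫ = (⟪w, τ⟫ + ‖w‖) / 2 := by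
    intro w
    rw [deflection, inner_add_left, real_inner_smul_left, real_inner_smul_left, hττ]; ring
  have hsq : ∀ w : EuclideanSpace ℝ (Fin d),
      ‖deflection 1 w τ‖ ^ 2 = ‖w‖ * ⟪deflection 1 w τ, τ⟫ := by
    intro w
    rw [hinner, deflection, norm_add_sq_real, norm_smul, norm_smul, real_inner_smul_left,
      real_inner_smul_right, hτ, Real.norm_eq_abs, Real.norm_eq_abs, mul_one, mul_pow, sq_abs, sq_abs]
    ring
  have hnorm : ∀ w : EuclideanSpace ℝ (Fin d), ‖deflection 1 w τ‖ ≤ ‖w‖ := by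
    intro w
    refine (norm_add_le _ _).trans ?_
    rw [norm_smul, norm_smul, hτ, Real.norm_eq_abs, Real.norm_eq_abs, one_mul, abs_of_nonneg (by positivity),
      abs_of_nonneg (by positivity)]
    linarith
  have hqx : q = (2 : ℝ) • x - ‖q‖ • τ := by
    rw [hx, deflection]; module
  have hpy : p = (2 : ℝ) • y - ‖p‖ • τ := by
    rw [hy, deflection]; module
  have hdiff : ‖q - p‖ ≤ 2 * ‖x - y‖ + (‖q‖ - ‖p‖) := by
    have : q - p = (2 : ℝ) • (x - y) - (‖q‖ - ‖p‖) • τ := by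
      nth_rw 1 [hqx, hpy]; module
    rw [this]
    refine (norm_sub_le _ _).trans ?_
    rw [norm_smul, norm_smul, hτ, Real.norm_eq_abs, Real.norm_eq_abs, abs_of_nonneg (sub_nonneg.2 hpq),
      abs_of_nonneg (by norm_num : (0 : ℝ) ≤ 2), mul_one]
  have hxy : ⟪x, τ⟫ - ⟪y, τ⟫ ≥ -‖x - y‖ := by
    rw [← inner_sub_left]
    have := abs_real_inner_le_norm (x - y) τ
    rw [hτ, mul_one] at this
    exact (abs_le.1 this).1
  have hnn : ‖x‖ ^ 2 - ‖y‖ ^ 2 ≤ ‖x - y‖ * (‖x‖ + ‖y‖) := by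
    have h1 : ‖x‖ - ‖y‖ ≤ ‖x - y‖ := norm_sub_norm_le x y
    nlinarith [norm_nonneg x, norm_nonneg y]
  have hcx : ‖q‖ / 2 ≤ ⟪x, τ⟫ := by rw [hx, hinner]; linarith
  rw [hsq q, hsq p] at hnn
  rcases (norm_nonneg q).eq_or_lt with h0 | h0
  · have : ‖p‖ = 0 := le_antisymm (h0 ▸ hpq) (norm_nonneg p)
    have := norm_nonneg (x - y)
    linarith
  · have h6 : (‖q‖ - ‖p‖) * ‖q‖ ≤ 6 * ‖x - y‖ * ‖q‖ := by
      have hxq := hnorm q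
      have hyp := hnorm p
      have hD := norm_nonneg (x - y)
      have a1 : (‖q‖ - ‖p‖) * (‖q‖ / 2) ≤ (‖q‖ - ‖p‖) * ⟪x, τ⟫ :=
        mul_le_mul_of_nonneg_left hcx (sub_nonneg.2 hpq)
      have a2 : ‖p‖ * (-‖x - y‖) ≤ ‖p‖ * (⟪x, τ⟫ - ⟪y, τ⟫) :=
        mul_le_mul_of_nonneg_left hxy (norm_nonneg p)
      have a3 : ‖x - y‖ * (‖x‖ + ‖y‖) ≤ ‖x - y‖ * (‖q‖ + ‖q‖) :=
        mul_le_mul_of_nonneg_left (by linarith) hD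
      have a4 : ‖p‖ * ‖x - y‖ ≤ ‖q‖ * ‖x - y‖ := mul_le_mul_of_nonneg_right hpq hD
      nlinarith
    have := le_of_mul_le_mul_right h6 h0
    linarith

lemma antilipschitz_deflection {τ : EuclideanSpace ℝ (Fin d)} (hτ : ‖τ‖ = 1) :
    AntilipschitzWith 8 (fun q : {q : EuclideanSpace ℝ (Fin d) | 0 ≤ ⟪q, τ⟫} =>
      deflection 1 (q : EuclideanSpace ℝ (Fin d)) τ) := by
  refine AntilipschitzWith.of_le_mul_dist fun q p => ?_
  rw [Subtype.dist_eq, dist_eq_norm, dist_eq_norm]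
  rcases le_total ‖(p : EuclideanSpace ℝ (Fin d))‖ ‖(q : EuclideanSpace ℝ (Fin d))‖ with h | h
  · exact norm_deflection_sub_ge hτ q.2 h
  · rw [norm_sub_rev, norm_sub_rev (deflection 1 (q : EuclideanSpace ℝ (Fin d)) τ)]
    exact norm_deflection_sub_ge hτ p.2 h

/-- No Jacobian is computed: an antilipschitz map controls the Hausdorff measure of preimages, and
in dimension `d` Hausdorff measure is proportional to Lebesgue measure. -/
lemma volume_deflection_preimage_le {τ : EuclideanSpace ℝ (Fin d)} (hτ : ‖τ‖ = 1)
    (A : Set (EuclideanSpace ℝ (Fin d))) :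
    volume ({q : EuclideanSpace ℝ (Fin d) | 0 ≤ ⟪q, τ⟫} ∩ (fun q => deflection 1 q τ) ⁻¹' A) ≤
      8 ^ d * volume A := by
  set H : Set (EuclideanSpace ℝ (Fin d)) := {q | 0 ≤ ⟪q, τ⟫}
  have : (Measure.hausdorffMeasure (d : ℝ) : Measure (EuclideanSpace ℝ (Fin d))).IsAddHaarMeasure := by
    simpa using isAddHaarMeasure_hausdorffMeasure (E := EuclideanSpace ℝ (Fin d))
  obtain ⟨c, hc⟩ : ∃ c : ℝ≥0, (volume : Measure (EuclideanSpace ℝ (Fin d))) =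
      c • Measure.hausdorffMeasure (d : ℝ) :=
    ⟨_, Measure.isAddLeftInvariant_eq_smul _ _⟩
  have h1 := (antilipschitz_deflection hτ).hausdorffMeasure_preimage_le (d := d) (by positivity) A
  have h2 : H ∩ (fun q => deflection 1 q τ) ⁻¹' A = Subtype.val ''
      ((fun q : H => deflection 1 (q : EuclideanSpace ℝ (Fin d)) τ) ⁻¹' A) := by
    ext q
    simp only [Set.mem_inter_iff, Set.mem_preimage, Set.mem_image, Subtype.exists, exists_and_right,
      exists_eq_right]
    exact ⟨fun h => ⟨h.1, h.2⟩, fun ⟨h, h'⟩ => ⟨h, h'⟩⟩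
  rw [h2, hc, Measure.smul_apply, Measure.smul_apply,
    isometry_subtype_coe.hausdorffMeasure_image (by left; positivity), mul_smul_comm]
  rw [ENNReal.rpow_natCast] at h1
  exact smul_le_smul_of_nonneg_left h1 zero_le

lemma measurable_deflection (ε : ℝ) : Measurable fun p : EuclideanSpace ℝ (Fin d) ×
    EuclideanSpace ℝ (Fin d) => deflection ε p.1 p.2 := by
  unfold deflection; fun_prop

lemma norm_deflection_le {τ : EuclideanSpace ℝ (Fin d)} (hτ : ‖τ‖ = 1)
    (q : EuclideanSpace ℝ (Fin d)) : ‖deflection 1 q τ‖ ≤ ‖q‖ := by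
  refine (norm_add_le _ _).trans ?_
  rw [norm_smul, norm_smul, hτ, Real.norm_eq_abs, Real.norm_eq_abs, one_mul, abs_of_nonneg (by positivity),
    abs_of_nonneg (by positivity)]
  linarith

lemma map_deflection_le {τ : EuclideanSpace ℝ (Fin d)} (hτ : ‖τ‖ = 1) (ρ : ℝ) :
    Measure.map (fun q => deflection 1 q τ)
      ((volume.restrict (Metric.ball 0 ρ)).restrict {q | 0 ≤ ⟪q, τ⟫}) ≤
        (8 : ℝ≥0∞) ^ d • volume.restrict (Metric.ball 0 ρ) := by
  have hT : Measurable fun q : EuclideanSpace ℝ (Fin d) => deflection 1 q τ := by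
    unfold deflection; fun_prop
  have hH : MeasurableSet {q : EuclideanSpace ℝ (Fin d) | 0 ≤ ⟪q, τ⟫} :=
    measurableSet_le measurable_const (by fun_prop)
  refine Measure.le_iff.2 fun s hs => ?_
  rw [Measure.map_apply hT hs, Measure.restrict_apply (hT hs),
    Measure.restrict_apply ((hT hs).inter hH), Measure.smul_apply, Measure.restrict_apply hs, smul_eq_mul]
  -- Deflection does not increase the norm, so the image of the ball stays in the same ball.
  refine le_trans (measure_mono ?_) (volume_deflection_preimage_le hτ (s ∩ Metric.ball 0 ρ))
  rintro q ⟨⟨h1, h2⟩, h3⟩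
  refine ⟨h2, h1, ?_⟩
  rw [mem_ball_zero_iff] at h3 ⊢
  exact (norm_deflection_le hτ q).trans_lt h3

lemma lintegral_deflection_le {τ : EuclideanSpace ℝ (Fin d)} (hτ : ‖τ‖ = 1) (ρ : ℝ)
    {g : EuclideanSpace ℝ (Fin d) → ℝ≥0∞} (hg : AEMeasurable g volume) :
    ∫⁻ q, g (deflection 1 q τ) ∂((volume.restrict (Metric.ball 0 ρ)).restrict {q | 0 ≤ ⟪q, τ⟫}) ≤
      8 ^ d * ∫⁻ z in Metric.ball 0 ρ, g z := by
  have hT : Measurable fun q : EuclideanSpace ℝ (Fin d) => deflection 1 q τ := by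
    unfold deflection; fun_prop
  have hle := map_deflection_le hτ ρ
  have hac : Measure.map (fun q => deflection 1 q τ)
      ((volume.restrict (Metric.ball 0 ρ)).restrict {q | 0 ≤ ⟪q, τ⟫}) ≪ volume :=
    hle.absolutelyContinuous.trans
      ((Measure.smul_absolutelyContinuous).trans Measure.absolutelyContinuous_restrict)
  rw [← lintegral_map' (hg.mono_ac hac) hT.aemeasurable]
  refine (lintegral_mono' hle le_rfl).trans ?_
  rw [lintegral_smul_measure, smul_eq_mul]

/-! ### Polar coordinates -/

lemma lintegral_polar [Nontrivial (EuclideanSpace ℝ (Fin d))]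
    {g : EuclideanSpace ℝ (Fin d) → ℝ≥0∞} :
    ∫⁻ q, g q = ∫⁻ p : Metric.sphere (0 : EuclideanSpace ℝ (Fin d)) 1 × Set.Ioi (0 : ℝ),
      g ((p.2 : ℝ) • (p.1 : EuclideanSpace ℝ (Fin d)))
        ∂((volume : Measure (EuclideanSpace ℝ (Fin d))).toSphere.prod
          (Measure.volumeIoiPow (Module.finrank ℝ (EuclideanSpace ℝ (Fin d)) - 1))) := by
  have h := (volume : Measure (EuclideanSpace ℝ (Fin d))).measurePreserving_homeomorphUnitSphereProd
  rw [← h.lintegral_comp_emb (Homeomorph.measurableEmbedding _) (fun p => g ((p.2 : ℝ) • (p.1 :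
    EuclideanSpace ℝ (Fin d))))]
  have e : ∀ x : ({0}ᶜ : Set (EuclideanSpace ℝ (Fin d))),
      ((homeomorphUnitSphereProd (EuclideanSpace ℝ (Fin d)) x).2 : ℝ) •
        ((homeomorphUnitSphereProd (EuclideanSpace ℝ (Fin d)) x).1 : EuclideanSpace ℝ (Fin d)) = x := by
    intro x
    have hx : ‖(x : EuclideanSpace ℝ (Fin d))‖ ≠ 0 := norm_ne_zero_iff.2 x.2
    simp [smul_smul, hx]
  simp only [e]
  rw [lintegral_subtype_comap (measurableSet_singleton _).compl g, restrict_compl_singleton]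

/-- The image of the measure `dq dσ` under `(q, σ) ↦ |q| σ` is a multiple of Lebesgue measure. -/
lemma lintegral_norm_smul_sphere [Nontrivial (EuclideanSpace ℝ (Fin d))] (ρ : ℝ)
    {g : EuclideanSpace ℝ (Fin d) → ℝ≥0∞} (hg : Measurable g) :
    ∫⁻ p : EuclideanSpace ℝ (Fin d) × Metric.sphere (0 : EuclideanSpace ℝ (Fin d)) 1,
      g (‖p.1‖ • (p.2 : EuclideanSpace ℝ (Fin d)))
      ∂((volume.restrict (Metric.ball (0 : EuclideanSpace ℝ (Fin d)) ρ)).prod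
        (volume : Measure (EuclideanSpace ℝ (Fin d))).toSphere) =
    (volume : Measure (EuclideanSpace ℝ (Fin d))).toSphere Set.univ *
      ∫⁻ z in Metric.ball 0 ρ, g z := by
  have hn : ∀ p : Metric.sphere (0 : EuclideanSpace ℝ (Fin d)) 1 × Set.Ioi (0 : ℝ),
      ‖(p.2 : ℝ) • (p.1 : EuclideanSpace ℝ (Fin d))‖ = p.2 := by
    intro p
    rw [norm_smul, norm_eq_of_mem_sphere, mul_one, Real.norm_of_nonneg (le_of_lt p.2.2)]
  set χ : ℝ → ℝ≥0∞ := (Set.Iio ρ).indicator 1 with hχ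
  have hχm : Measurable χ := measurable_one.indicator measurableSet_Iio
  have hball : ∀ G : EuclideanSpace ℝ (Fin d) → ℝ≥0∞, ∫⁻ z in Metric.ball 0 ρ, G z =
      ∫⁻ z, χ ‖z‖ * G z := by
    intro G
    rw [← lintegral_indicator measurableSet_ball]
    refine lintegral_congr fun z => ?_
    by_cases hz : ‖z‖ < ρ
    · rw [Set.indicator_of_mem (mem_ball_zero_iff.2 hz), hχ,
        Set.indicator_of_mem (Set.mem_Iio.2 hz)]; simp
    · rw [Set.indicator_of_notMem (fun h => hz (mem_ball_zero_iff.1 h)), hχ,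
        Set.indicator_of_notMem (fun h => hz (Set.mem_Iio.1 h)), zero_mul]
  have hm : Measurable fun p : EuclideanSpace ℝ (Fin d) ×
      Metric.sphere (0 : EuclideanSpace ℝ (Fin d)) 1 =>
      g (‖p.1‖ • (p.2 : EuclideanSpace ℝ (Fin d))) := by fun_prop
  have hm1 : Measurable fun r : Set.Ioi (0 : ℝ) => ∫⁻ σ : Metric.sphere (0 :
      EuclideanSpace ℝ (Fin d)) 1, g ((r : ℝ) • (σ : EuclideanSpace ℝ (Fin d)))
      ∂(volume : Measure (EuclideanSpace ℝ (Fin d))).toSphere :=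
    Measurable.lintegral_prod_right' (f := fun p : Set.Ioi (0 : ℝ) ×
      Metric.sphere (0 : EuclideanSpace ℝ (Fin d)) 1 =>
        g ((p.1 : ℝ) • (p.2 : EuclideanSpace ℝ (Fin d)))) (by fun_prop)
  rw [lintegral_prod _ hm.aemeasurable, hball, hball, lintegral_polar, lintegral_polar]
  simp only [hn]
  -- With `q = rω` the integrand depends on `r` and `σ` only, so the integral over `ω` contributes
  -- just the area of the sphere.
  have h1 := lintegral_prod_mul (μ := (volume : Measure (EuclideanSpace ℝ (Fin d))).toSphere)
      (ν := Measure.volumeIoiPow (Module.finrank ℝ (EuclideanSpace ℝ (Fin d)) - 1))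
      (f := fun _ => 1) (g := fun r : Set.Ioi (0 : ℝ) => χ r * ∫⁻ σ : Metric.sphere (0 :
      EuclideanSpace ℝ (Fin d)) 1, g ((r : ℝ) • (σ : EuclideanSpace ℝ (Fin d)))
      ∂(volume : Measure (EuclideanSpace ℝ (Fin d))).toSphere) aemeasurable_const (by fun_prop)
  simp only [one_mul, lintegral_const] at h1
  rw [h1, lintegral_prod_symm _ (by fun_prop)]
  congr 1
  exact lintegral_congr fun r => (lintegral_const_mul _ (by fun_prop)).symm

/-! ### Quadratic estimates for the collision integrals -/

/-- The measure `dq dσ` on `{|q| < ρ} × 𝕊^{d-1}`. -/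
noncomputable def collisionMeasure (d : ℕ) (ρ : ℝ) :
    Measure (EuclideanSpace ℝ (Fin d) × Metric.sphere (0 : EuclideanSpace ℝ (Fin d)) 1) :=
  (volume.restrict (Metric.ball (0 : EuclideanSpace ℝ (Fin d)) ρ)).prod
    (volume : Measure (EuclideanSpace ℝ (Fin d))).toSphere

instance (d : ℕ) (ρ : ℝ) : IsFiniteMeasure (collisionMeasure d ρ) := by
  have : IsFiniteMeasure ((volume : Measure (EuclideanSpace ℝ (Fin d))).restrict
      (Metric.ball 0 ρ)) := isFiniteMeasure_restrict.2 measure_ball_lt_top.ne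
  unfold collisionMeasure
  infer_instance

/-- The part of the collision sphere on which `q` and `ε σ` form an acute angle. -/
def halfCollisions (d : ℕ) (ε : ℝ) :
    Set (EuclideanSpace ℝ (Fin d) × Metric.sphere (0 : EuclideanSpace ℝ (Fin d)) 1) :=
  {p | 0 ≤ ε * ⟪p.1, (p.2 : EuclideanSpace ℝ (Fin d))⟫}

lemma measurableSet_halfCollisions (ε : ℝ) : MeasurableSet (halfCollisions d ε) :=
  measurableSet_le measurable_const (by fun_prop)

/-- Cauchy–Schwarz inequality with a weight. -/
lemma sq_lintegral_mul_le {α : Type*} [MeasurableSpace α] {μ : Measure α} {φ ψ : α → ℝ≥0∞}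
    (hφ : AEMeasurable φ μ) (hψ : AEMeasurable ψ μ) :
    (∫⁻ x, φ x * ψ x ∂μ) ^ 2 ≤ (∫⁻ x, φ x ∂μ) * ∫⁻ x, φ x * ψ x ^ 2 ∂μ := by
  -- Hölder for the factors `φ^{1/2}` and `φ^{1/2} ψ`.
  have h := ENNReal.lintegral_mul_le_Lp_mul_Lq μ (p := 2) (q := 2)
    (by constructor <;> norm_num) (hφ.pow_const (1 / 2 : ℝ)) ((hφ.pow_const (1 / 2 : ℝ)).mul hψ)
  have hs : ∀ t : ℝ≥0∞, (t ^ (1 / 2 : ℝ)) ^ (2 : ℝ) = t := fun t => by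
    rw [← ENNReal.rpow_mul]; norm_num
  have hs' : ∀ t : ℝ≥0∞, t ^ (1 / 2 : ℝ) * t ^ (1 / 2 : ℝ) = t := fun t => by
    rw [← sq, ← ENNReal.rpow_two, hs]
  simp only [Pi.mul_apply, ENNReal.mul_rpow_of_nonneg _ _ (by norm_num : (0 : ℝ) ≤ 2), hs,
    ← mul_assoc, hs', ENNReal.rpow_two] at h
  calc _ ≤ ((∫⁻ x, φ x ∂μ) ^ (1 / 2 : ℝ) * (∫⁻ x, φ x * ψ x ^ 2 ∂μ) ^ (1 / 2 : ℝ)) ^ 2 := by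
        gcongr
    _ = _ := by rw [mul_pow, ← ENNReal.rpow_two, hs, ← ENNReal.rpow_two, hs]

lemma quasiMeasurePreserving_sub_const (c : EuclideanSpace ℝ (Fin d)) :
    Measure.QuasiMeasurePreserving (fun v => v - c) (cubeMeasure d) volume :=
  (measurePreserving_sub_right volume c).quasiMeasurePreserving.mono_left
    (by rw [cubeMeasure]; exact Measure.absolutelyContinuous_restrict)

/-- Functions in `L²` are measurable only up to null sets, so the substitutions `v'`, `v'_*`, `v_*`
must pull null sets back to null sets. For fixed collision parameters each is a translation in `v`,
which is enough. -/
lemma quasiMeasurePreserving_sub {X : Type*} [MeasurableSpace X] {ν : Measure X} [SFinite ν]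
    {a : X → EuclideanSpace ℝ (Fin d)} (ha : Measurable a) :
    Measure.QuasiMeasurePreserving (fun p : EuclideanSpace ℝ (Fin d) × X => p.1 - a p.2)
      ((cubeMeasure d).prod ν) volume :=
  QuasiMeasurePreserving.prod_of_left (by fun_prop)
    (.of_forall fun x => quasiMeasurePreserving_sub_const (a x))

lemma measurable_deflection_sphere (ε : ℝ) :
    Measurable fun p : EuclideanSpace ℝ (Fin d) × Metric.sphere (0 : EuclideanSpace ℝ (Fin d)) 1 =>
      deflection ε p.1 p.2 :=
  (measurable_deflection ε).comp (measurable_fst.prodMk (measurable_subtype_coe.comp measurable_snd))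

/-- The covering number `n` is uniform in `v` because translating a periodic function does not
change its integral over the cube. Later estimates take this bound as a hypothesis, so that all
share one `n`. -/
lemma exists_lintegral_ball_sub_le (d : ℕ) (ρ : ℝ) :
    ∃ n : ℕ, ∀ F : EuclideanSpace ℝ (Fin d) → ℝ≥0∞, HasPeriods F →
      ∀ (v : EuclideanSpace ℝ (Fin d)) (ε : ℝ), (ε = 1 ∨ ε = -1) →
      ∫⁻ z in Metric.ball 0 ρ, F (v - ε • z) ≤ n * ∫⁻ v, F v ∂(cubeMeasure d) := by
  obtain ⟨n, hn⟩ := exists_lintegral_ball_le d ρ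
  refine ⟨n, fun F hF v ε hε => ?_⟩
  have hplus : ∫⁻ z in Metric.ball 0 ρ, F (z + v) ≤ n * ∫⁻ v, F v ∂(cubeMeasure d) := by
    rw [← hF.lintegral_comp_add v]
    exact hn _ fun j w => by rw [add_right_comm, hF]
  rcases hε with rfl | rfl
  · have h := (Measure.measurePreserving_neg
      (volume : Measure (EuclideanSpace ℝ (Fin d)))).setLIntegral_comp_preimage_emb
      (MeasurableEquiv.neg _).measurableEmbedding (fun z => F (z + v)) (Metric.ball 0 ρ)
    have hb : Neg.neg ⁻¹' Metric.ball (0 : EuclideanSpace ℝ (Fin d)) ρ = Metric.ball 0 ρ := by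
      ext z; simp
    rw [hb] at h
    rw [← h] at hplus
    convert hplus using 3 with z
    rw [one_smul, sub_eq_neg_add]
  · convert hplus using 3 with z
    rw [neg_one_smul, sub_neg_eq_add, add_comm]

lemma map_norm_smul_sphere [Nontrivial (EuclideanSpace ℝ (Fin d))] (ρ : ℝ) :
    Measure.map (fun p : EuclideanSpace ℝ (Fin d) ×
        Metric.sphere (0 : EuclideanSpace ℝ (Fin d)) 1 =>
        ‖p.1‖ • (p.2 : EuclideanSpace ℝ (Fin d))) (collisionMeasure d ρ) =
      (volume : Measure (EuclideanSpace ℝ (Fin d))).toSphere Set.univ •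
        volume.restrict (Metric.ball 0 ρ) := by
  have hm : Measurable fun p : EuclideanSpace ℝ (Fin d) ×
      Metric.sphere (0 : EuclideanSpace ℝ (Fin d)) 1 =>
      ‖p.1‖ • (p.2 : EuclideanSpace ℝ (Fin d)) := by fun_prop
  refine Measure.ext_of_lintegral _ fun g hg => ?_
  rw [lintegral_map hg hm, lintegral_smul_measure, smul_eq_mul]
  exact lintegral_norm_smul_sphere ρ hg

/-- The surface measure of the unit sphere. -/
noncomputable def sphereArea (d : ℕ) : ℝ≥0∞ :=
  (volume : Measure (EuclideanSpace ℝ (Fin d))).toSphere Set.univ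

lemma sphereArea_ne_top (d : ℕ) : sphereArea d ≠ ⊤ := measure_ne_top _ _

lemma lintegral_norm_smul_le [Nontrivial (EuclideanSpace ℝ (Fin d))] {ρ : ℝ} {n : ℕ}
    (hn : ∀ F : EuclideanSpace ℝ (Fin d) → ℝ≥0∞, HasPeriods F →
      ∀ (v : EuclideanSpace ℝ (Fin d)) (ε : ℝ), (ε = 1 ∨ ε = -1) →
      ∫⁻ z in Metric.ball 0 ρ, F (v - ε • z) ≤ n * ∫⁻ v, F v ∂(cubeMeasure d))
    {F : EuclideanSpace ℝ (Fin d) → ℝ≥0∞} (hF : HasPeriods F) (hFm : AEMeasurable F volume)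
    (v : EuclideanSpace ℝ (Fin d)) {ε : ℝ} (hε : ε = 1 ∨ ε = -1) :
    ∫⁻ p, F (v - ε • (‖p.1‖ • (p.2 : EuclideanSpace ℝ (Fin d)))) ∂(collisionMeasure d ρ) ≤
      sphereArea d * (n * ∫⁻ v, F v ∂(cubeMeasure d)) := by
  have hm : Measurable fun p : EuclideanSpace ℝ (Fin d) ×
      Metric.sphere (0 : EuclideanSpace ℝ (Fin d)) 1 =>
      ‖p.1‖ • (p.2 : EuclideanSpace ℝ (Fin d)) := by fun_prop
  have hg : AEMeasurable (fun z => F (v - ε • z)) volume := by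
    rcases hε with rfl | rfl
    · simpa [Function.comp_def] using hFm.comp_quasiMeasurePreserving (quasiMeasurePreserving_sub_left volume v)
    · simpa [Function.comp_def] using hFm.comp_quasiMeasurePreserving
        (measurePreserving_add_left volume v).quasiMeasurePreserving
  have hac : Measure.map (fun p : EuclideanSpace ℝ (Fin d) ×
        Metric.sphere (0 : EuclideanSpace ℝ (Fin d)) 1 =>
        ‖p.1‖ • (p.2 : EuclideanSpace ℝ (Fin d))) (collisionMeasure d ρ) ≪ volume := by
    rw [map_norm_smul_sphere]
    exact (Measure.smul_absolutelyContinuous).trans Measure.absolutelyContinuous_restrict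
  have h := lintegral_map' (hg.mono_ac hac) hm.aemeasurable
  rw [← h, map_norm_smul_sphere, lintegral_smul_measure, smul_eq_mul]
  exact mul_le_mul_right (hn F hF v ε hε) _

/-- At fixed `σ`, put `τ = εσ`: the condition becomes `⟪q, τ⟫ ≥ 0` and the deflection becomes
`deflection 1 q τ`, so both signs reduce to `lintegral_deflection_le`. -/
lemma lintegral_halfCollisions_le {ρ : ℝ} {n : ℕ}
    (hn : ∀ F : EuclideanSpace ℝ (Fin d) → ℝ≥0∞, HasPeriods F →
      ∀ (v : EuclideanSpace ℝ (Fin d)) (ε : ℝ), (ε = 1 ∨ ε = -1) →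
      ∫⁻ z in Metric.ball 0 ρ, F (v - ε • z) ≤ n * ∫⁻ v, F v ∂(cubeMeasure d))
    {F : EuclideanSpace ℝ (Fin d) → ℝ≥0∞} (hF : HasPeriods F) (hFm : AEMeasurable F volume)
    {ε : ℝ} (hε : ε = 1 ∨ ε = -1) {v : EuclideanSpace ℝ (Fin d)}
    (hv : AEMeasurable (fun p : EuclideanSpace ℝ (Fin d) ×
        Metric.sphere (0 : EuclideanSpace ℝ (Fin d)) 1 => F (v - deflection ε p.1 p.2))
      (collisionMeasure d ρ)) :
    ∫⁻ p in halfCollisions d ε, F (v - deflection ε p.1 p.2) ∂(collisionMeasure d ρ) ≤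
      8 ^ d * (n * ∫⁻ v, F v ∂(cubeMeasure d)) * sphereArea d := by
  have hmeas := measurableSet_halfCollisions (d := d) ε
  have hg : AEMeasurable (fun z => F (v - z)) volume :=
    hFm.comp_quasiMeasurePreserving (quasiMeasurePreserving_sub_left volume v)
  rw [← lintegral_indicator hmeas, collisionMeasure,
    lintegral_prod_symm _ (hv.indicator hmeas), sphereArea, ← lintegral_const]
  refine lintegral_mono fun σ => ?_
  set τ : EuclideanSpace ℝ (Fin d) := ε • (σ : EuclideanSpace ℝ (Fin d)) with hτ
  have hτ1 : ‖τ‖ = 1 := by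
    rw [hτ, norm_smul, norm_eq_of_mem_sphere, mul_one]
    rcases hε with rfl | rfl <;> simp
  have hdef : ∀ q, deflection ε q (σ : EuclideanSpace ℝ (Fin d)) = deflection 1 q τ := by
    intro q; rw [deflection, deflection, hτ]; module
  have hset : MeasurableSet {q : EuclideanSpace ℝ (Fin d) | 0 ≤ ⟪q, τ⟫} :=
    measurableSet_le measurable_const (by fun_prop)
  calc _ = ∫⁻ q in Metric.ball 0 ρ, ({q : EuclideanSpace ℝ (Fin d) | 0 ≤ ⟪q, τ⟫}).indicator
        (fun q => F (v - deflection 1 q τ)) q := by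
        refine lintegral_congr fun q => ?_
        have hiff : (q, σ) ∈ halfCollisions d ε ↔
            q ∈ {q : EuclideanSpace ℝ (Fin d) | 0 ≤ ⟪q, τ⟫} := by
          simp [halfCollisions, hτ, real_inner_smul_right]
        by_cases hq : (q, σ) ∈ halfCollisions d ε
        · rw [Set.indicator_of_mem hq, Set.indicator_of_mem (hiff.1 hq), ← hdef]
        · rw [Set.indicator_of_notMem hq, Set.indicator_of_notMem (fun h => hq (hiff.2 h))]
    _ ≤ 8 ^ d * ∫⁻ z in Metric.ball 0 ρ, F (v - z) := by
        rw [lintegral_indicator hset]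
        exact lintegral_deflection_le hτ1 ρ hg
    _ ≤ _ := by
        gcongr
        simpa using hn F hF v 1 (Or.inl rfl)

lemma aemeasurable_comp_sub {X : Type*} [MeasurableSpace X] {ν : Measure X} [SFinite ν]
    {F : EuclideanSpace ℝ (Fin d) → ℝ≥0∞} (hFm : AEMeasurable F volume)
    {a : X → EuclideanSpace ℝ (Fin d)} (ha : Measurable a) :
    AEMeasurable (fun p : EuclideanSpace ℝ (Fin d) × X => F (p.1 - a p.2))
      ((cubeMeasure d).prod ν) :=
  hFm.comp_quasiMeasurePreserving (quasiMeasurePreserving_sub ha)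

lemma ae_aemeasurable_comp_sub {X : Type*} [MeasurableSpace X] {ν : Measure X} [SFinite ν]
    {F : EuclideanSpace ℝ (Fin d) → ℝ≥0∞} (hFm : AEMeasurable F volume)
    {a : X → EuclideanSpace ℝ (Fin d)} (ha : Measurable a) :
    ∀ᵐ v ∂(cubeMeasure d), AEMeasurable (fun x => F (v - a x)) ν := by
  filter_upwards [(aemeasurable_comp_sub (ν := ν) hFm ha).aestronglyMeasurable.prodMk_left] with v h
  exact h.aemeasurable

/-- Cauchy–Schwarz with weight `F`: the factor `∫ F` is bounded uniformly in `v` thanks to the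
half-collision condition. In the factor `∫ F H²` that condition is dropped, because the order of
integration can be exchanged and the remaining deflection depends on `|q|σ` only. -/
lemma lintegral_sq_gain_le [Nontrivial (EuclideanSpace ℝ (Fin d))] {ρ : ℝ} {n : ℕ}
    (hn : ∀ F : EuclideanSpace ℝ (Fin d) → ℝ≥0∞, HasPeriods F →
      ∀ (v : EuclideanSpace ℝ (Fin d)) (ε : ℝ), (ε = 1 ∨ ε = -1) →
      ∫⁻ z in Metric.ball 0 ρ, F (v - ε • z) ≤ n * ∫⁻ v, F v ∂(cubeMeasure d))
    {F H : EuclideanSpace ℝ (Fin d) → ℝ≥0∞} (hF : HasPeriods F) (hFm : AEMeasurable F volume)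
    (hH : HasPeriods H) (hHm : AEMeasurable H volume) {ε : ℝ} (hε : ε = 1 ∨ ε = -1) :
    ∫⁻ v, (∫⁻ p in halfCollisions d ε, F (v - deflection ε p.1 p.2) * H (v - deflection (-ε) p.1 p.2)
        ∂(collisionMeasure d ρ)) ^ 2 ∂(cubeMeasure d) ≤
      (8 ^ d * (n * ∫⁻ v, F v ∂(cubeMeasure d)) * sphereArea d) *
        ((sphereArea d * (n * ∫⁻ v, F v ∂(cubeMeasure d))) * ∫⁻ v, H v ^ 2 ∂(cubeMeasure d)) := by
  set M := collisionMeasure d ρ with hM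
  set K := 8 ^ d * (n * ∫⁻ v, F v ∂(cubeMeasure d)) * sphereArea d with hK
  have ha := measurable_deflection_sphere (d := d) ε
  have hb := measurable_deflection_sphere (d := d) (-ε)
  have hFa := aemeasurable_comp_sub (ν := M) hFm ha
  have hHb := aemeasurable_comp_sub (ν := M) hHm hb
  have hprod := hFa.mul (hHb.pow_const 2)
  have hc : Measurable fun p : EuclideanSpace ℝ (Fin d) ×
      Metric.sphere (0 : EuclideanSpace ℝ (Fin d)) 1 =>
      ε • (‖p.1‖ • (p.2 : EuclideanSpace ℝ (Fin d))) := by fun_prop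
  have hFc := aemeasurable_comp_sub (ν := M) hFm hc
  have hH2 : AEMeasurable (fun p : EuclideanSpace ℝ (Fin d) × (EuclideanSpace ℝ (Fin d) ×
      Metric.sphere (0 : EuclideanSpace ℝ (Fin d)) 1) => H p.1 ^ 2) ((cubeMeasure d).prod M) := by
    have : AEMeasurable (fun v => H v ^ 2) (cubeMeasure d) := by
      rw [cubeMeasure]; exact (hHm.pow_const 2).restrict
    exact this.comp_quasiMeasurePreserving Measure.quasiMeasurePreserving_fst
  calc _ ≤ ∫⁻ v, K * ∫⁻ p, F (v - deflection ε p.1 p.2) * H (v - deflection (-ε) p.1 p.2) ^ 2 ∂M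
        ∂(cubeMeasure d) := by
        refine lintegral_mono_ae ?_
        filter_upwards [ae_aemeasurable_comp_sub (ν := M) hFm ha,
          ae_aemeasurable_comp_sub (ν := M) hHm hb] with v h1 h2
        refine (sq_lintegral_mul_le h1.restrict h2.restrict).trans ?_
        exact mul_le_mul' (lintegral_halfCollisions_le hn hF hFm hε h1)
          (lintegral_mono' Measure.restrict_le_self le_rfl)
    _ = K * ∫⁻ v, ∫⁻ p, F (v - deflection ε p.1 p.2) * H (v - deflection (-ε) p.1 p.2) ^ 2 ∂M
        ∂(cubeMeasure d) := lintegral_const_mul'' _ hprod.lintegral_prod_right'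
    _ = K * ∫⁻ p, ∫⁻ v, F (v - deflection ε p.1 p.2) * H (v - deflection (-ε) p.1 p.2) ^ 2
        ∂(cubeMeasure d) ∂M := by rw [lintegral_lintegral_swap hprod]
    -- At fixed `p`, translate so that the argument of `H` becomes `v`; the two deflections differ
    -- by `ε|q|σ`.
    _ = K * ∫⁻ p, ∫⁻ v, F (v - ε • (‖p.1‖ • (p.2 : EuclideanSpace ℝ (Fin d)))) * H v ^ 2
        ∂(cubeMeasure d) ∂M := by
        congr 1
        refine lintegral_congr fun p => ?_
        have hper : HasPeriods fun v => F (v - deflection ε p.1 p.2) *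
            H (v - deflection (-ε) p.1 p.2) ^ 2 := fun j v => by
          simp only [add_sub_right_comm, hF j, hH j]
        rw [← hper.lintegral_comp_add (deflection (-ε) p.1 p.2)]
        refine lintegral_congr fun v => ?_
        rw [add_sub_cancel_right]
        congr 2
        rw [deflection, deflection]; module
    _ = K * ∫⁻ v, ∫⁻ p, F (v - ε • (‖p.1‖ • (p.2 : EuclideanSpace ℝ (Fin d)))) * H v ^ 2
        ∂M ∂(cubeMeasure d) := by
        have h : AEMeasurable (Function.uncurry fun (v : EuclideanSpace ℝ (Fin d))
          (p : EuclideanSpace ℝ (Fin d) × Metric.sphere (0 : EuclideanSpace ℝ (Fin d)) 1) =>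
          F (v - ε • (‖p.1‖ • (p.2 : EuclideanSpace ℝ (Fin d)))) * H v ^ 2)
            ((cubeMeasure d).prod M) := hFc.mul hH2
        rw [lintegral_lintegral_swap h]
    _ ≤ K * ∫⁻ v, (sphereArea d * (n * ∫⁻ v, F v ∂(cubeMeasure d))) * H v ^ 2
        ∂(cubeMeasure d) := by
        refine mul_le_mul_right (lintegral_mono_ae ?_) _
        filter_upwards [ae_aemeasurable_comp_sub (ν := M) hFm hc] with v h1
        rw [lintegral_mul_const'' _ h1]
        exact mul_le_mul_left (lintegral_norm_smul_le hn hF hFm v hε) _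
    _ = _ := by
        rw [lintegral_const_mul'']
        rw [cubeMeasure]; exact (hHm.pow_const 2).restrict

/-- The integral of `F(v'_*) H(v') + F(v_*) H(v)` over all collisions. -/
noncomputable def collisionMajorant (ρ : ℝ) (F H : EuclideanSpace ℝ (Fin d) → ℝ≥0∞)
    (v : EuclideanSpace ℝ (Fin d)) : ℝ≥0∞ :=
  ∫⁻ p, (F (v - deflection 1 p.1 p.2) * H (v - deflection (-1) p.1 p.2) + F (v - p.1) * H v)
    ∂(collisionMeasure d ρ)

lemma sq_lintegral_cube_le {F : EuclideanSpace ℝ (Fin d) → ℝ≥0∞} (hFm : AEMeasurable F volume) :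
    (∫⁻ v, F v ∂(cubeMeasure d)) ^ 2 ≤
      cubeMeasure d Set.univ * ∫⁻ v, F v ^ 2 ∂(cubeMeasure d) := by
  have hm : AEMeasurable F (cubeMeasure d) := by rw [cubeMeasure]; exact hFm.restrict
  simpa using sq_lintegral_mul_le (φ := fun _ => 1) aemeasurable_const hm

lemma ENNReal_add_sq_le (a b : ℝ≥0∞) : (a + b) ^ 2 ≤ 2 * (a ^ 2 + b ^ 2) := by
  have := ENNReal.rpow_add_le_mul_rpow_add_rpow a b (p := 2) (by norm_num)
  norm_num at this
  simpa using this

lemma lintegral_sq_le_of_ae_le {α : Type*} [MeasurableSpace α] {μ : Measure α}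
    {Θ G₁ G₂ H : α → ℝ≥0∞} {c A₁ A₂ A₃ : ℝ≥0∞} (h₁ : AEMeasurable G₁ μ)
    (h₂ : AEMeasurable G₂ μ) (hH : AEMeasurable H μ)
    (hle : ∀ᵐ v ∂μ, Θ v ≤ 2 * (2 * (G₁ v + G₂ v) + c * H v))
    (b₁ : ∫⁻ v, G₁ v ∂μ ≤ A₁) (b₂ : ∫⁻ v, G₂ v ∂μ ≤ A₂) (b₃ : c * ∫⁻ v, H v ∂μ ≤ A₃) :
    ∫⁻ v, Θ v ∂μ ≤ 2 * (2 * (A₁ + A₂) + A₃) := by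
  refine (lintegral_mono_ae hle).trans ?_
  rw [lintegral_const_mul'' _ (by fun_prop), lintegral_add_left' (by fun_prop),
    lintegral_const_mul'' _ (by fun_prop), lintegral_add_left' h₁, lintegral_const_mul'' _ hH]
  gcongr

/-- The gain is split over the two half-collision sets and the loss is `H(v)` times an `L¹` integral
of `F`. The `L¹` norms become `L²` norms because the cube has finite measure. -/
theorem exists_lintegral_sq_collisionMajorant_le [Nontrivial (EuclideanSpace ℝ (Fin d))] (ρ : ℝ) :
    ∃ C : ℝ≥0, ∀ F H : EuclideanSpace ℝ (Fin d) → ℝ≥0∞, HasPeriods F → AEMeasurable F volume →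
      HasPeriods H → AEMeasurable H volume →
      ∫⁻ v, collisionMajorant ρ F H v ^ 2 ∂(cubeMeasure d) ≤
        C * ((∫⁻ v, F v ^ 2 ∂(cubeMeasure d)) * ∫⁻ v, H v ^ 2 ∂(cubeMeasure d)) := by
  obtain ⟨n, hn⟩ := exists_lintegral_ball_sub_le d ρ
  set S := sphereArea d
  set V := cubeMeasure d Set.univ
  set k : ℝ≥0∞ := (8 ^ d * n * S) * (S * n) * V with hk
  set l : ℝ≥0∞ := (S * n) ^ 2 * V with hl
  have hS : S ≠ ⊤ := sphereArea_ne_top d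
  have hV : V ≠ ⊤ := measure_ne_top _ _
  have hkt : k ≠ ⊤ := by finiteness
  have hlt : l ≠ ⊤ := by finiteness
  have hgain : ∀ F H : EuclideanSpace ℝ (Fin d) → ℝ≥0∞, HasPeriods F → AEMeasurable F volume →
      HasPeriods H → AEMeasurable H volume → ∀ ε : ℝ, (ε = 1 ∨ ε = -1) →
      ∫⁻ v, (∫⁻ p in halfCollisions d ε, F (v - deflection ε p.1 p.2) *
        H (v - deflection (-ε) p.1 p.2) ∂(collisionMeasure d ρ)) ^ 2 ∂(cubeMeasure d) ≤
      k * ((∫⁻ v, F v ^ 2 ∂(cubeMeasure d)) * ∫⁻ v, H v ^ 2 ∂(cubeMeasure d)) := by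
    intro F H hF hFm hH hHm ε hε
    refine (lintegral_sq_gain_le hn hF hFm hH hHm hε).trans ?_
    calc _ = (8 ^ d * n * S) * (S * n) * (∫⁻ v, F v ∂(cubeMeasure d)) ^ 2 *
          ∫⁻ v, H v ^ 2 ∂(cubeMeasure d) := by ring
      _ ≤ (8 ^ d * n * S) * (S * n) * (V * ∫⁻ v, F v ^ 2 ∂(cubeMeasure d)) *
          ∫⁻ v, H v ^ 2 ∂(cubeMeasure d) := by gcongr; exact sq_lintegral_cube_le hFm
      _ = _ := by rw [hk]; ring
  refine ⟨(2 * (2 * (k + k) + l)).toNNReal, fun F H hF hFm hH hHm => ?_⟩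
  rw [ENNReal.coe_toNNReal (by finiteness)]
  set M := collisionMeasure d ρ with hM
  have hHc : AEMeasurable H (cubeMeasure d) := by rw [cubeMeasure]; exact hHm.restrict
  set G1 : EuclideanSpace ℝ (Fin d) → ℝ≥0∞ := fun v => ∫⁻ p in halfCollisions d 1,
    F (v - deflection 1 p.1 p.2) * H (v - deflection (-1) p.1 p.2) ∂M with hG1
  set G2 : EuclideanSpace ℝ (Fin d) → ℝ≥0∞ := fun v => ∫⁻ p in halfCollisions d (-1),
    F (v - deflection 1 p.1 p.2) * H (v - deflection (-1) p.1 p.2) ∂M with hG2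
  have hGm : ∀ s : Set (EuclideanSpace ℝ (Fin d) × Metric.sphere (0 : EuclideanSpace ℝ (Fin d)) 1),
      AEMeasurable (fun v => ∫⁻ p in s,
        F (v - deflection 1 p.1 p.2) * H (v - deflection (-1) p.1 p.2) ∂M) (cubeMeasure d) := by
    intro s
    exact ((aemeasurable_comp_sub (ν := M.restrict s) hFm (measurable_deflection_sphere 1)).mul
      (aemeasurable_comp_sub (ν := M.restrict s) hHm
        (measurable_deflection_sphere (-1)))).lintegral_prod_right'
  have hG1m : AEMeasurable (fun v => G1 v ^ 2) (cubeMeasure d) := (hGm _).pow_const 2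
  have hG2m : AEMeasurable (fun v => G2 v ^ 2) (cubeMeasure d) := (hGm _).pow_const 2
  have b1 := hgain F H hF hFm hH hHm 1 (Or.inl rfl)
  -- On `q·σ ≤ 0` it is `v'`, the argument of `H`, that is well spread, so `H` now serves as the
  -- weight.
  have b2 := hgain H F hH hHm hF hFm (-1) (Or.inr rfl)
  rw [neg_neg] at b2
  have hpt : ∀ᵐ v ∂(cubeMeasure d), collisionMajorant ρ F H v ^ 2 ≤
      2 * (2 * (G1 v ^ 2 + G2 v ^ 2) + ((S * n) * ∫⁻ v, F v ∂(cubeMeasure d)) ^ 2 * H v ^ 2) := by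
    filter_upwards [
      ae_aemeasurable_comp_sub (ν := M) hFm (measurable_deflection_sphere (d := d) 1),
      ae_aemeasurable_comp_sub (ν := M) hHm (measurable_deflection_sphere (d := d) (-1)),
      ae_aemeasurable_comp_sub (ν := M) hFm (a := Prod.fst) measurable_fst] with v h1 h2 h3
    have hsplit : ∫⁻ p, F (v - deflection 1 p.1 p.2) * H (v - deflection (-1) p.1 p.2) ∂M ≤
        G1 v + G2 v := by
      have huniv : halfCollisions d 1 ∪ halfCollisions d (-1) = Set.univ := by
        ext p
        simp only [halfCollisions, Set.mem_union, Set.mem_ofPred_eq, Set.mem_univ, iff_true]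
        rcases le_total 0 ⟪p.1, (p.2 : EuclideanSpace ℝ (Fin d))⟫ with h | h
        · left; simpa using h
        · right; simpa using h
      rw [← setLIntegral_univ, ← huniv]
      exact lintegral_union_le _ _ _
    have hloss : ∫⁻ p, F (v - p.1) * H v ∂M ≤ ((S * n) * ∫⁻ v, F v ∂(cubeMeasure d)) * H v := by
      rw [lintegral_mul_const'' _ h3]
      gcongr
      rw [hM, collisionMeasure, lintegral_prod _ h3]
      simp only [lintegral_const]
      rw [lintegral_mul_const' _ _ (measure_ne_top _ _), mul_comm, mul_assoc]
      gcongr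
      · exact le_rfl
      · simpa using hn F hF v 1 (Or.inl rfl)
    have hadd : collisionMajorant ρ F H v = ∫⁻ p, F (v - deflection 1 p.1 p.2) *
        H (v - deflection (-1) p.1 p.2) ∂M + ∫⁻ p, F (v - p.1) * H v ∂M :=
      lintegral_add_left' (h1.mul h2) _
    rw [hadd]
    calc _ ≤ ((G1 v + G2 v) + ((S * n) * ∫⁻ v, F v ∂(cubeMeasure d)) * H v) ^ 2 := by gcongr
      _ ≤ 2 * ((G1 v + G2 v) ^ 2 + (((S * n) * ∫⁻ v, F v ∂(cubeMeasure d)) * H v) ^ 2) :=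
        ENNReal_add_sq_le _ _
      _ ≤ _ := by rw [mul_pow]; gcongr; exact ENNReal_add_sq_le _ _
  have b3 : ((S * n) * ∫⁻ v, F v ∂(cubeMeasure d)) ^ 2 * ∫⁻ v, H v ^ 2 ∂(cubeMeasure d) ≤
      l * ((∫⁻ v, F v ^ 2 ∂(cubeMeasure d)) * ∫⁻ v, H v ^ 2 ∂(cubeMeasure d)) := by
    rw [mul_pow, hl]
    calc _ ≤ (S * n) ^ 2 * (V * ∫⁻ v, F v ^ 2 ∂(cubeMeasure d)) *
          ∫⁻ v, H v ^ 2 ∂(cubeMeasure d) := by gcongr; exact sq_lintegral_cube_le hFm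
      _ = _ := by ring
  have b2' : ∫⁻ v, G2 v ^ 2 ∂(cubeMeasure d) ≤
      k * ((∫⁻ v, F v ^ 2 ∂(cubeMeasure d)) * ∫⁻ v, H v ^ 2 ∂(cubeMeasure d)) := by
    rw [mul_comm (∫⁻ v, F v ^ 2 ∂(cubeMeasure d))]
    refine le_trans (le_of_eq (lintegral_congr fun v => ?_)) b2
    rw [hG2]
    simp only [mul_comm (F _)]
  refine (lintegral_sq_le_of_ae_le hG1m hG2m (hHc.pow_const 2) hpt b1 b2' b3).trans_eq ?_
  ring

/-! ### Continuity of the collision operator on `L²` -/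

/-- Measurability passes from one period cell to each of its countably many lattice translates,
which cover almost everything. -/
lemma IsPeriodic.aestronglyMeasurable {f : EuclideanSpace ℝ (Fin d) → ℂ} (hf : IsPeriodic f)
    (hm : AEStronglyMeasurable f (cubeMeasure d)) : AEStronglyMeasurable f volume := by
  rw [cubeMeasure_eq_halfCube] at hm
  have hper : HasPeriods f := hf
  have h0 := isAddFundamentalDomain_halfCube (0 : EuclideanSpace ℝ (Fin d))
  rw [zero_vadd] at h0
  have hg : ∀ g : (Submodule.span ℤ (Set.range (latticeBasis d))).toAddSubgroup,
      AEStronglyMeasurable f (volume.restrict (g +ᵥ halfCube d)) := fun g =>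
    (h0.aestronglyMeasurable_on_iff (isAddFundamentalDomain_halfCube (g : EuclideanSpace ℝ (Fin d)))
      fun g v => hper.add_mem g.2 v).1 hm
  have := aestronglyMeasurable_iUnion_iff.2 hg
  rwa [Measure.restrict_congr_set h0.iUnion_vadd_ae_eq, Measure.restrict_univ] at this

lemma sq_eLpNorm_two {α E : Type*} [MeasurableSpace α] [NormedAddCommGroup E] (μ : Measure α)
    (f : α → E) : eLpNorm f 2 μ ^ 2 = ∫⁻ x, ‖f x‖ₑ ^ 2 ∂μ := by
  rw [eLpNorm_eq_lintegral_rpow_enorm_toReal (by simp) (by simp), ← ENNReal.rpow_two, ← ENNReal.rpow_mul]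
  simp

/-- The values of the collision kernel. -/
noncomputable def kernelFactor (B : ℝ → ℝ → ℝ)
    (p : EuclideanSpace ℝ (Fin d) × Metric.sphere (0 : EuclideanSpace ℝ (Fin d)) 1) : ℂ :=
  (B ‖p.1‖ ⟪‖p.1‖⁻¹ • p.1, (p.2 : EuclideanSpace ℝ (Fin d))⟫ : ℝ)

lemma measurable_kernelFactor {B : ℝ → ℝ → ℝ} (hB : IsCollisionKernel B) :
    Measurable (kernelFactor (d := d) B) := by
  have h := hB.measurable
  refine Complex.measurable_ofReal.comp (h.comp (f := fun p : EuclideanSpace ℝ (Fin d) ×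
    Metric.sphere (0 : EuclideanSpace ℝ (Fin d)) 1 =>
      (‖p.1‖, ⟪‖p.1‖⁻¹ • p.1, (p.2 : EuclideanSpace ℝ (Fin d))⟫)) ?_)
  fun_prop

lemma exists_kernelFactor_bound {B : ℝ → ℝ → ℝ} (hB : IsCollisionKernel B) (d : ℕ) (ρ : ℝ) :
    ∃ K : ℝ≥0, ∀ᵐ p ∂(collisionMeasure d ρ), ‖kernelFactor B p‖ ≤ K := by
  obtain ⟨K, hK⟩ := hB.locallyBounded ρ
  refine ⟨K.toNNReal, ?_⟩
  have hae : ∀ᵐ p ∂(collisionMeasure d ρ), p.1 ∈ Metric.ball (0 : EuclideanSpace ℝ (Fin d)) ρ :=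
    Measure.quasiMeasurePreserving_fst.ae (ae_restrict_mem measurableSet_ball)
  filter_upwards [hae] with p hp
  rw [mem_ball_zero_iff] at hp
  -- This includes `q = 0`, where `‖q‖⁻¹ = 0` and the cosine is `0`.
  have hc : |⟪‖p.1‖⁻¹ • p.1, (p.2 : EuclideanSpace ℝ (Fin d))⟫| ≤ 1 := by
    refine (abs_real_inner_le_norm _ _).trans ?_
    rw [norm_eq_of_mem_sphere, mul_one, norm_smul, norm_inv, norm_norm]
    exact inv_mul_le_one
  rw [kernelFactor, Complex.norm_real, Real.norm_of_nonneg (hB.nonneg _ _ (norm_nonneg _) hc)]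
  exact (hK _ _ (norm_nonneg _) hp.le hc).trans (Real.le_coe_toNNReal K)

/-- The collision integrand, polarized. -/
noncomputable def collisionIntegrand (B : ℝ → ℝ → ℝ) (f g : EuclideanSpace ℝ (Fin d) → ℂ)
    (v : EuclideanSpace ℝ (Fin d))
    (p : EuclideanSpace ℝ (Fin d) × Metric.sphere (0 : EuclideanSpace ℝ (Fin d)) 1) : ℂ :=
  kernelFactor B p * (f (v - deflection 1 p.1 p.2) * g (v - deflection (-1) p.1 p.2) -
    f (v - p.1) * g v)

/-- The polarized collision operator. -/
noncomputable def collisionBilin (B : ℝ → ℝ → ℝ) (R : ℝ) (f g : EuclideanSpace ℝ (Fin d) → ℂ)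
    (v : EuclideanSpace ℝ (Fin d)) : ℂ :=
  ∫ p, collisionIntegrand B f g v p ∂(collisionMeasure d (2 * R))

lemma collisionOp_eq_collisionBilin (B : ℝ → ℝ → ℝ) (R : ℝ) (f : EuclideanSpace ℝ (Fin d) → ℂ) :
    collisionOp B R f = collisionBilin B R f f := by
  ext v
  rw [collisionOp, collisionBilin, collisionMeasure]
  refine integral_congr_ae (.of_forall fun p => ?_)
  have h1 : v - (1 / 2 : ℝ) • p.1 - (‖p.1‖ / 2) • (p.2 : EuclideanSpace ℝ (Fin d)) =
      v - deflection 1 p.1 p.2 := by rw [deflection]; module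
  have h2 : v - (1 / 2 : ℝ) • p.1 + (‖p.1‖ / 2) • (p.2 : EuclideanSpace ℝ (Fin d)) =
      v - deflection (-1) p.1 p.2 := by rw [deflection]; module
  simp only [collisionIntegrand, kernelFactor, h1, h2]

lemma aestronglyMeasurable_collisionIntegrand {B : ℝ → ℝ → ℝ} (hB : IsCollisionKernel B)
    {f g : EuclideanSpace ℝ (Fin d) → ℂ} (hf : AEStronglyMeasurable f volume)
    (hg : AEStronglyMeasurable g volume) (ρ : ℝ) :
    AEStronglyMeasurable (fun x : EuclideanSpace ℝ (Fin d) × (EuclideanSpace ℝ (Fin d) ×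
      Metric.sphere (0 : EuclideanSpace ℝ (Fin d)) 1) => collisionIntegrand B f g x.1 x.2)
      ((cubeMeasure d).prod (collisionMeasure d ρ)) := by
  have hgc : AEStronglyMeasurable g (cubeMeasure d) := by rw [cubeMeasure]; exact hg.restrict
  refine AEStronglyMeasurable.mul ?_ (AEStronglyMeasurable.sub (AEStronglyMeasurable.mul ?_ ?_)
    (AEStronglyMeasurable.mul ?_ ?_))
  · exact ((measurable_kernelFactor hB).comp measurable_snd).aestronglyMeasurable
  · exact hf.comp_quasiMeasurePreserving (quasiMeasurePreserving_sub (measurable_deflection_sphere 1))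
  · exact hg.comp_quasiMeasurePreserving (quasiMeasurePreserving_sub (measurable_deflection_sphere (-1)))
  · exact hf.comp_quasiMeasurePreserving (quasiMeasurePreserving_sub (a := Prod.fst) measurable_fst)
  · exact hgc.comp_quasiMeasurePreserving Measure.quasiMeasurePreserving_fst

lemma lintegral_enorm_collisionIntegrand_le {B : ℝ → ℝ → ℝ} {K : ℝ≥0} {ρ : ℝ}
    (hK : ∀ᵐ p ∂(collisionMeasure d ρ), ‖kernelFactor B p‖ ≤ K)
    (f g : EuclideanSpace ℝ (Fin d) → ℂ) (v : EuclideanSpace ℝ (Fin d)) :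
    ∫⁻ p, ‖collisionIntegrand B f g v p‖ₑ ∂(collisionMeasure d ρ) ≤
      K * collisionMajorant ρ (fun w => ‖f w‖ₑ) (fun w => ‖g w‖ₑ) v := by
  rw [collisionMajorant, ← lintegral_const_mul' _ _ ENNReal.coe_ne_top]
  refine lintegral_mono_ae ?_
  filter_upwards [hK] with p hp
  rw [collisionIntegrand, enorm_mul]
  refine mul_le_mul' (enorm_le_coe.2 hp) ?_
  refine enorm_sub_le.trans ?_
  rw [enorm_mul, enorm_mul]

/-- Everything follows by domination with `collisionMajorant`. Almost everywhere integrability is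
recorded because the operator is additive in each argument only where its integrals converge. -/
theorem exists_collisionBilin_bound [Nontrivial (EuclideanSpace ℝ (Fin d))] {B : ℝ → ℝ → ℝ}
    (hB : IsCollisionKernel B) (R : ℝ) :
    ∃ A : ℝ, 0 ≤ A ∧ ∀ f g : EuclideanSpace ℝ (Fin d) → ℂ, IsPeriodic f →
      MemLp f 2 (cubeMeasure d) → IsPeriodic g → MemLp g 2 (cubeMeasure d) →
      (∀ᵐ v ∂(cubeMeasure d),
        Integrable (collisionIntegrand B f g v) (collisionMeasure d (2 * R))) ∧
      MemLp (collisionBilin B R f g) 2 (cubeMeasure d) ∧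
      l2Norm (collisionBilin B R f g) ≤ A * (l2Norm f * l2Norm g) := by
  obtain ⟨K, hK⟩ := exists_kernelFactor_bound hB d (2 * R)
  obtain ⟨C, hC⟩ := exists_lintegral_sq_collisionMajorant_le (d := d) (2 * R)
  refine ⟨K * Real.sqrt C, by positivity, fun f g hf hf2 hg hg2 => ?_⟩
  have hfm := hf.aestronglyMeasurable hf2.1
  have hgm := hg.aestronglyMeasurable hg2.1
  have hfp : HasPeriods fun w => ‖f w‖ₑ := fun j v => by simp only [hf j v]
  have hgp : HasPeriods fun w => ‖g w‖ₑ := fun j v => by simp only [hg j v]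
  have hJ := aestronglyMeasurable_collisionIntegrand hB hfm hgm (2 * R)
  have hm : AEStronglyMeasurable (collisionBilin B R f g) (cubeMeasure d) :=
    hJ.integral_prod_right'
  have hmaj := hC _ _ hfp hfm.enorm hgp hgm.enorm
  rw [← sq_eLpNorm_two, ← sq_eLpNorm_two] at hmaj
  have hfin : (C : ℝ≥0∞) * (eLpNorm f 2 (cubeMeasure d) ^ 2 * eLpNorm g 2 (cubeMeasure d) ^ 2) < ⊤ := by
    have := hf2.2.ne; have := hg2.2.ne; finiteness
  have hMm : AEMeasurable (fun v => collisionMajorant (2 * R) (fun w => ‖f w‖ₑ) (fun w => ‖g w‖ₑ) v ^ 2)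
      (cubeMeasure d) := by
    refine AEMeasurable.pow_const ?_ 2
    have h1 := aemeasurable_comp_sub (ν := collisionMeasure d (2 * R)) hfm.enorm
      (measurable_deflection_sphere (d := d) 1)
    have h2 := aemeasurable_comp_sub (ν := collisionMeasure d (2 * R)) hgm.enorm
      (measurable_deflection_sphere (d := d) (-1))
    have h3 := aemeasurable_comp_sub (ν := collisionMeasure d (2 * R)) hfm.enorm
      (a := Prod.fst) measurable_fst
    have h4 : AEMeasurable (fun x : EuclideanSpace ℝ (Fin d) × (EuclideanSpace ℝ (Fin d) ×
        Metric.sphere (0 : EuclideanSpace ℝ (Fin d)) 1) => ‖g x.1‖ₑ)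
        ((cubeMeasure d).prod (collisionMeasure d (2 * R))) :=
      hg2.1.enorm.comp_quasiMeasurePreserving Measure.quasiMeasurePreserving_fst
    exact ((h1.mul h2).add (h3.mul h4)).lintegral_prod_right'
  have hint : ∀ᵐ v ∂(cubeMeasure d),
      Integrable (collisionIntegrand B f g v) (collisionMeasure d (2 * R)) := by
    filter_upwards [hJ.prodMk_left, ae_lt_top' hMm (hmaj.trans_lt hfin).ne] with v h1 h2
    refine ⟨h1, (lintegral_enorm_collisionIntegrand_le hK f g v).trans_lt ?_⟩
    exact ENNReal.mul_lt_top ENNReal.coe_lt_top ((ENNReal.pow_lt_top_iff.1 h2).resolve_right (by norm_num))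
  have hsq : eLpNorm (collisionBilin B R f g) 2 (cubeMeasure d) ^ 2 ≤
      (K * NNReal.sqrt C * (eLpNorm f 2 (cubeMeasure d) * eLpNorm g 2 (cubeMeasure d))) ^ 2 := by
    rw [sq_eLpNorm_two]
    calc _ ≤ ∫⁻ v, K ^ 2 * collisionMajorant (2 * R) (fun w => ‖f w‖ₑ) (fun w => ‖g w‖ₑ) v ^ 2
          ∂(cubeMeasure d) := by
          refine lintegral_mono fun v => ?_
          rw [← mul_pow]
          gcongr
          exact (enorm_integral_le_lintegral_enorm _).trans
            (lintegral_enorm_collisionIntegrand_le hK f g v)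
      _ = K ^ 2 * ∫⁻ v, collisionMajorant (2 * R) (fun w => ‖f w‖ₑ) (fun w => ‖g w‖ₑ) v ^ 2
          ∂(cubeMeasure d) := lintegral_const_mul' _ _ (by finiteness)
      _ ≤ K ^ 2 * (C * (eLpNorm f 2 (cubeMeasure d) ^ 2 * eLpNorm g 2 (cubeMeasure d) ^ 2)) := by
          gcongr
      _ = _ := by
          have : (C : ℝ≥0∞) = (NNReal.sqrt C : ℝ≥0∞) ^ 2 := by
            rw [← ENNReal.coe_pow, NNReal.sq_sqrt]
          rw [this]; ring
  have hle := (ENNReal.pow_le_pow_left_iff (by norm_num)).1 hsq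
  have hne : (K : ℝ≥0∞) * NNReal.sqrt C * (eLpNorm f 2 (cubeMeasure d) * eLpNorm g 2 (cubeMeasure d)) ≠ ⊤ := by
    have := hf2.2.ne; have := hg2.2.ne; finiteness
  refine ⟨hint, ⟨hm, hle.trans_lt hne.lt_top⟩, ?_⟩
  have := ENNReal.toReal_mono hne hle
  simpa [l2Norm, ENNReal.toReal_mul] using this

lemma l2Norm_add_le {f g : EuclideanSpace ℝ (Fin d) → ℂ} (hf : MemLp f 2 (cubeMeasure d))
    (hg : MemLp g 2 (cubeMeasure d)) : l2Norm (f + g) ≤ l2Norm f + l2Norm g := by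
  rw [l2Norm, l2Norm, l2Norm, ← ENNReal.toReal_add hf.2.ne hg.2.ne]
  exact ENNReal.toReal_mono (ENNReal.add_ne_top.2 ⟨hf.2.ne, hg.2.ne⟩)
    (eLpNorm_add_le hf.1 hg.1 (by norm_num))

lemma IsPeriodic.sub {f g : EuclideanSpace ℝ (Fin d) → ℂ} (hf : IsPeriodic f)
    (hg : IsPeriodic g) : IsPeriodic (f - g) := fun j v => by
  simp only [Pi.sub_apply, hf j v, hg j v]

/-- Polarization: `Q(f,f) - Q(g,g) = Q(f-g,f) + Q(g,f-g)`, valid at almost every `v`. -/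
theorem exists_collisionOp_bound [Nontrivial (EuclideanSpace ℝ (Fin d))] {B : ℝ → ℝ → ℝ}
    (hB : IsCollisionKernel B) (R : ℝ) :
    ∃ A : ℝ, 0 ≤ A ∧ (∀ f : EuclideanSpace ℝ (Fin d) → ℂ, IsPeriodic f →
      MemLp f 2 (cubeMeasure d) → MemLp (collisionOp B R f) 2 (cubeMeasure d)) ∧
      ∀ f g : EuclideanSpace ℝ (Fin d) → ℂ, IsPeriodic f →
        MemLp f 2 (cubeMeasure d) → IsPeriodic g → MemLp g 2 (cubeMeasure d) →
        l2Norm (collisionOp B R f - collisionOp B R g) ≤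
          A * ((l2Norm f + l2Norm g) * l2Norm (f - g)) := by
  obtain ⟨A, hA0, hA⟩ := exists_collisionBilin_bound (d := d) hB R
  refine ⟨A, hA0, fun f hf hf2 => ?_, fun f g hf hf2 hg hg2 => ?_⟩
  · rw [collisionOp_eq_collisionBilin]
    exact (hA f f hf hf2 hf hf2).2.1
  · obtain ⟨i1, m1, n1⟩ := hA (f - g) f (hf.sub hg) (hf2.sub hg2) hf hf2
    obtain ⟨i2, m2, n2⟩ := hA g (f - g) hg hg2 (hf.sub hg) (hf2.sub hg2)
    obtain ⟨i3, -, -⟩ := hA f f hf hf2 hf hf2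
    obtain ⟨i4, -, -⟩ := hA g g hg hg2 hg hg2
    have hae : collisionOp B R f - collisionOp B R g =ᵐ[cubeMeasure d]
        collisionBilin B R (f - g) f + collisionBilin B R g (f - g) := by
      filter_upwards [i1, i2, i3, i4] with v h1 h2 h3 h4
      rw [collisionOp_eq_collisionBilin, collisionOp_eq_collisionBilin, Pi.sub_apply, Pi.add_apply,
        collisionBilin, collisionBilin, collisionBilin, collisionBilin, ← integral_sub h3 h4,
        ← integral_add h1 h2]
      refine integral_congr_ae (.of_forall fun p => ?_)
      simp only [collisionIntegrand, Pi.sub_apply]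
      ring
    rw [l2Norm, eLpNorm_congr_ae hae, ← l2Norm]
    refine (l2Norm_add_le m1 m2).trans ((add_le_add n1 n2).trans_eq ?_)
    ring

/-! ### Collisions of trigonometric polynomials -/

/-- The kernel mode of the collision operator with frequencies `k` and `l`. -/
noncomputable def kernelMode (B : ℝ → ℝ → ℝ) (k l : Fin d → ℤ)
    (p : EuclideanSpace ℝ (Fin d) × Metric.sphere (0 : EuclideanSpace ℝ (Fin d)) 1) : ℂ :=
  kernelFactor B p * (fourierMode k (-deflection 1 p.1 p.2) * fourierMode l (-deflection (-1) p.1 p.2) -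
    fourierMode k (-p.1))

lemma integrable_kernelMode {B : ℝ → ℝ → ℝ} (hB : IsCollisionKernel B) (k l : Fin d → ℤ) (ρ : ℝ) :
    Integrable (kernelMode B k l) (collisionMeasure d ρ) := by
  obtain ⟨K, hK⟩ := exists_kernelFactor_bound hB d ρ
  refine Integrable.of_bound (C := K * 2) ?_ ?_
  · have h1 := measurable_deflection_sphere (d := d) 1
    have h2 := measurable_deflection_sphere (d := d) (-1)
    have hk := (continuous_fourierMode k).measurable
    have hl := (continuous_fourierMode l).measurable
    exact ((measurable_kernelFactor hB).mul (((hk.comp h1.neg).mul (hl.comp h2.neg)).sub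
      (hk.comp measurable_fst.neg))).aestronglyMeasurable
  · filter_upwards [hK] with p hp
    rw [kernelMode, norm_mul]
    refine mul_le_mul hp ((norm_sub_le _ _).trans ?_) (norm_nonneg _) K.2
    rw [norm_mul, norm_fourierMode, norm_fourierMode, norm_fourierMode]
    norm_num

/-- The integrand for modes `k` and `l` is `fourierMode (k + l) v` times a function of the collision
parameters alone, so the operator sends the pair to a multiple of the mode `k + l`. -/
lemma collisionOp_mem_trigPoly {B : ℝ → ℝ → ℝ} (hB : IsCollisionKernel B) (R : ℝ) {N : ℕ}
    {p : EuclideanSpace ℝ (Fin d) → ℂ} (hp : p ∈ trigPoly d N) :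
    collisionOp B R p ∈ trigPoly d (2 * N) := by
  obtain ⟨c, rfl⟩ := mem_trigPoly_iff.1 hp
  have hmem : ∀ k ∈ freqBox d N, ∀ l ∈ freqBox d N, fourierMode (k + l) ∈ trigPoly d (2 * N) := by
    intro k hk l hl
    refine Submodule.subset_span ⟨k + l, fun j => ?_, rfl⟩
    have h1 := mem_freqBox.1 hk j
    have h2 := mem_freqBox.1 hl j
    simp only [Pi.add_apply]
    push_cast
    constructor <;> linarith [h1.1, h1.2, h2.1, h2.2]
  suffices h : collisionOp B R (∑ k ∈ freqBox d N, c k • fourierMode k) =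
      ∑ k ∈ freqBox d N, ∑ l ∈ freqBox d N,
        (c k * c l * ∫ p, kernelMode B k l p ∂(collisionMeasure d (2 * R))) • fourierMode (k + l) by
    rw [h]
    exact Submodule.sum_mem _ fun k hk => Submodule.sum_mem _ fun l hl =>
      Submodule.smul_mem _ _ (hmem k hk l hl)
  ext v
  rw [collisionOp_eq_collisionBilin, collisionBilin]
  have hpt : ∀ p, collisionIntegrand B (∑ k ∈ freqBox d N, c k • fourierMode k)
      (∑ k ∈ freqBox d N, c k • fourierMode k) v p =
      ∑ k ∈ freqBox d N, ∑ l ∈ freqBox d N,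
        (c k * c l * fourierMode (k + l) v) * kernelMode B k l p := by
    intro p
    simp only [collisionIntegrand, Finset.sum_apply, Pi.smul_apply, smul_eq_mul]
    rw [Finset.sum_mul_sum, Finset.sum_mul_sum, ← Finset.sum_sub_distrib, Finset.mul_sum]
    refine Finset.sum_congr rfl fun k _ => ?_
    rw [← Finset.sum_sub_distrib, Finset.mul_sum]
    refine Finset.sum_congr rfl fun l _ => ?_
    simp only [kernelMode, fourierMode_add, sub_eq_add_neg v, fourierMode_apply_add]
    ring
  simp only [hpt]
  have hi := fun k l => (integrable_kernelMode hB k l (2 * R)).const_mul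
    (c k * c l * fourierMode (k + l) v)
  rw [integral_finsetSum _ fun k _ => integrable_finsetSum _ fun l _ => hi k l]
  simp only [Finset.sum_apply, Pi.smul_apply, smul_eq_mul]
  refine Finset.sum_congr rfl fun k _ => ?_
  rw [integral_finsetSum _ fun l _ => hi k l]
  refine Finset.sum_congr rfl fun l _ => ?_
  rw [integral_const_mul]
  ring

/-! ### Moments -/

lemma continuous_collisionInvariant (i : Unit ⊕ Fin d ⊕ Unit) :
    Continuous (collisionInvariant (d := d) i) := by
  rcases i with i | i | i
  · exact continuous_const
  · exact (EuclideanSpace.proj (𝕜 := ℝ) i).continuous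
  · exact continuous_norm.pow 2

lemma integrable_mul_collisionInvariant {f : EuclideanSpace ℝ (Fin d) → ℂ}
    (hf : MemLp f 2 (cubeMeasure d)) (i : Unit ⊕ Fin d ⊕ Unit) :
    Integrable (fun v => f v * (collisionInvariant i v : ℂ)) (cubeMeasure d) := by
  have h := memLp_of_continuous (Complex.continuous_ofReal.comp (continuous_collisionInvariant i)) 2
  exact hf.integrable_mul h

lemma moments_apply (f : EuclideanSpace ℝ (Fin d) → ℂ) (i : Unit ⊕ Fin d ⊕ Unit) :
    moments f i = ∫ v, f v * (collisionInvariant i v : ℂ) ∂(cubeMeasure d) := rfl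

lemma moments_add {f g : EuclideanSpace ℝ (Fin d) → ℂ} (hf : MemLp f 2 (cubeMeasure d))
    (hg : MemLp g 2 (cubeMeasure d)) : moments (f + g) = moments f + moments g := by
  ext i
  simp only [moments_apply, PiLp.add_apply, Pi.add_apply, add_mul]
  exact integral_add (integrable_mul_collisionInvariant hf i) (integrable_mul_collisionInvariant hg i)

lemma moments_smul (c : ℂ) (f : EuclideanSpace ℝ (Fin d) → ℂ) :
    moments (c • f) = c • moments f := by
  ext i
  simp only [moments_apply, PiLp.smul_apply, Pi.smul_apply, smul_eq_mul, mul_assoc]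
  exact integral_const_mul _ _

lemma moments_sub {f g : EuclideanSpace ℝ (Fin d) → ℂ} (hf : MemLp f 2 (cubeMeasure d))
    (hg : MemLp g 2 (cubeMeasure d)) : moments (f - g) = moments f - moments g := by
  have h : f - g = f + (-1 : ℂ) • g := by simp [sub_eq_add_neg]
  rw [h, moments_add hf (hg.const_smul _), moments_smul]
  simp [sub_eq_add_neg]

/-- Cauchy–Schwarz for each component: every collision invariant is in `L²` of the cube. -/
lemma exists_norm_moments_le (d : ℕ) :
    ∃ C : ℝ, 0 ≤ C ∧ ∀ f : EuclideanSpace ℝ (Fin d) → ℂ, MemLp f 2 (cubeMeasure d) →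
      ‖moments f‖ ≤ C * l2Norm f := by
  have hc : ∀ i : Unit ⊕ Fin d ⊕ Unit, ∃ C : ℝ, 0 ≤ C ∧
      ∀ f : EuclideanSpace ℝ (Fin d) → ℂ, MemLp f 2 (cubeMeasure d) →
        ‖moments f i‖ ≤ C * l2Norm f := by
    intro i
    have h := memLp_of_continuous (Complex.continuous_ofReal.comp (continuous_collisionInvariant i)) 2
    generalize hφ : Complex.ofReal ∘ collisionInvariant (d := d) i = φ at h
    refine ⟨l2Norm φ, l2Norm_nonneg _, fun f hf => ?_⟩
    have hm : moments f i = ∫ v, (f • φ) v ∂(cubeMeasure d) := by rw [moments_apply, ← hφ]; rfl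
    rw [hm]
    have h1 : eLpNorm (f • φ) 1 (cubeMeasure d) ≤
        eLpNorm f 2 (cubeMeasure d) * eLpNorm φ 2 (cubeMeasure d) :=
      eLpNorm_smul_le_mul_eLpNorm h.1 hf.1
    have h2 : ‖∫ v, (f • φ) v ∂(cubeMeasure d)‖ₑ ≤ eLpNorm (f • φ) 1 (cubeMeasure d) := by
      rw [eLpNorm_one_eq_lintegral_enorm]
      exact enorm_integral_le_lintegral_enorm _
    have h3 := ENNReal.toReal_mono (ENNReal.mul_ne_top hf.2.ne h.2.ne) (h2.trans h1)
    rw [toReal_enorm, ENNReal.toReal_mul] at h3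
    exact h3.trans_eq (mul_comm _ _)
  choose C hC0 hC using hc
  refine ⟨Real.sqrt (∑ i, C i ^ 2), by positivity, fun f hf => ?_⟩
  rw [EuclideanSpace.norm_eq]
  calc Real.sqrt (∑ i, ‖moments f i‖ ^ 2) ≤ Real.sqrt (∑ i, C i ^ 2 * l2Norm f ^ 2) := by
        refine Real.sqrt_le_sqrt (Finset.sum_le_sum fun i _ => ?_)
        rw [← mul_pow]
        exact pow_le_pow_left₀ (norm_nonneg _) (hC i f hf) 2
    _ = _ := by
        rw [← Finset.sum_mul, Real.sqrt_mul (by positivity), Real.sqrt_sq (l2Norm_nonneg _)]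

/-! ### Moments of the lowest Fourier modes -/

/-- The one-dimensional moments `∫ x^n e^{i m x}`. -/
noncomputable def lineMoment (m : ℤ) (n : ℕ) : ℂ :=
  ∫ x in Set.Icc (-Real.pi) Real.pi, (x : ℂ) ^ n * Complex.exp (Complex.I * (m * x))

lemma integral_cube_prod (f : Fin d → ℝ → ℂ) :
    ∫ v, ∏ i, f i (v i) ∂(cubeMeasure d) =
      ∏ i, ∫ x in Set.Icc (-Real.pi) Real.pi, f i x := by
  rw [← integral_fintype_prod_eq_prod (μ := fun _ => volume.restrict (Set.Icc (-Real.pi) Real.pi)),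
    ← Measure.restrict_pi_pi]
  have h := (EuclideanSpace.volume_preserving_symm_measurableEquiv_toLp (Fin d)).setIntegral_preimage_emb
    (MeasurableEquiv.measurableEmbedding _) (fun x => ∏ i, f i (x i))
    (Set.univ.pi fun _ => Set.Icc (-Real.pi) Real.pi)
  have e1 : {v : EuclideanSpace ℝ (Fin d) | ∀ j, v j ∈ Set.Icc (-Real.pi) Real.pi} =
      (MeasurableEquiv.toLp 2 (Fin d → ℝ)).symm ⁻¹'
        Set.univ.pi fun _ => Set.Icc (-Real.pi) Real.pi := by
    ext v; simp only [Set.mem_ofPred_eq, Set.mem_preimage, Set.mem_univ_pi]; rfl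
  rw [cubeMeasure, e1]
  exact h

lemma integral_fourierMode_mul_pow (k : Fin d → ℤ) (i : Fin d) (n : ℕ) :
    ∫ v, fourierMode k v * (v i : ℂ) ^ n ∂(cubeMeasure d) =
      ∏ l, lineMoment (k l) (if l = i then n else 0) := by
  simp only [lineMoment]
  rw [← integral_cube_prod]
  refine integral_congr_ae (.of_forall fun v => ?_)
  simp only [fourierMode, Finset.mul_sum, Complex.exp_sum, Finset.prod_mul_distrib]
  rw [mul_comm]
  congr 1
  rw [Finset.prod_eq_single i (by intro l _ hl; simp [hl]) (by simp)]
  simp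

lemma integral_Icc_eq_sub {F f : ℝ → ℂ} (hF : ∀ x, HasDerivAt F (f x) x) (hf : Continuous f) :
    ∫ x in Set.Icc (-Real.pi) Real.pi, f x = F Real.pi - F (-Real.pi) := by
  rw [integral_Icc_eq_integral_Ioc, ← intervalIntegral.integral_of_le (by linarith [Real.pi_pos])]
  exact intervalIntegral.integral_eq_sub_of_hasDerivAt (fun x _ => hF x) (hf.intervalIntegrable _ _)

lemma lineMoment_zero_zero : lineMoment 0 0 = 2 * Real.pi := by
  simp [lineMoment, Real.pi_pos.le]
  ring

lemma hasDerivAt_cexp_mul_ofReal (c : ℂ) (x : ℝ) :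
    HasDerivAt (fun x : ℝ => Complex.exp (c * x)) (c * Complex.exp (c * x)) x := by
  have h := (((hasDerivAt_id (x : ℂ)).const_mul c).cexp).comp_ofReal
  simpa [mul_comm] using h

lemma cexp_I_mul_unit_mul_pi {m : ℤ} (hm : m = 1 ∨ m = -1) :
    Complex.exp (Complex.I * m * Real.pi) = -1 ∧
      Complex.exp (Complex.I * m * (-Real.pi : ℝ)) = -1 := by
  have h1 : Complex.exp (Complex.I * Real.pi) = -1 := by
    rw [mul_comm]; exact Complex.exp_pi_mul_I
  have h2 : Complex.exp (-(Complex.I * Real.pi)) = -1 := by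
    rw [Complex.exp_neg, h1]; norm_num
  rcases hm with rfl | rfl
  · exact ⟨by simpa using h1, by simpa using h2⟩
  · exact ⟨by simpa using h2, by simpa using h1⟩

/-- Lets `-im` stand for `1/(im)` in the antiderivatives below. -/
lemma sq_I_mul_unit {m : ℤ} (hm : m = 1 ∨ m = -1) : (Complex.I * m) ^ 2 = -1 := by
  rcases hm with rfl | rfl <;> simp

lemma lineMoment_unit_zero {m : ℤ} (hm : m = 1 ∨ m = -1) : lineMoment m 0 = 0 := by
  obtain ⟨e1, e2⟩ := cexp_I_mul_unit_mul_pi hm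
  have hc := sq_I_mul_unit hm
  have h := integral_Icc_eq_sub (F := fun x => -(Complex.I * m) * Complex.exp (Complex.I * m * x))
    (f := fun x => (x : ℂ) ^ 0 * Complex.exp (Complex.I * (m * x)))
    (fun x => ((hasDerivAt_cexp_mul_ofReal (Complex.I * m) x).const_mul _).congr_deriv (by
      rw [← mul_assoc Complex.I m x]
      linear_combination (-Complex.exp (Complex.I * m * x)) * hc)) (by fun_prop)
  rw [lineMoment, h, e1, e2, sub_self]

lemma lineMoment_unit_one {m : ℤ} (hm : m = 1 ∨ m = -1) :
    lineMoment m 1 = 2 * Real.pi * (Complex.I * m) := by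
  obtain ⟨e1, e2⟩ := cexp_I_mul_unit_mul_pi hm
  have hc := sq_I_mul_unit hm
  have h := integral_Icc_eq_sub
    (F := fun x => (1 - Complex.I * m * x) * Complex.exp (Complex.I * m * x))
    (f := fun x => (x : ℂ) ^ 1 * Complex.exp (Complex.I * (m * x)))
    (fun x => by
      have h1 := ((hasDerivAt_id (x : ℂ)).comp_ofReal.const_mul (Complex.I * m)).const_sub 1
      refine (h1.mul (hasDerivAt_cexp_mul_ofReal (Complex.I * m) x)).congr_deriv ?_
      rw [← mul_assoc Complex.I m x]
      simp only [id]
      linear_combination (-x * Complex.exp (Complex.I * m * x)) * hc) (by fun_prop)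
  rw [lineMoment, h, e1, e2]
  push_cast
  ring

lemma lineMoment_unit_two {m : ℤ} (hm : m = 1 ∨ m = -1) : lineMoment m 2 = -4 * Real.pi := by
  obtain ⟨e1, e2⟩ := cexp_I_mul_unit_mul_pi hm
  have hc := sq_I_mul_unit hm
  have h := integral_Icc_eq_sub
    (F := fun x => (-(Complex.I * m) * (x : ℂ) ^ 2 + 2 * x + 2 * (Complex.I * m)) *
      Complex.exp (Complex.I * m * x))
    (f := fun x => (x : ℂ) ^ 2 * Complex.exp (Complex.I * (m * x)))
    (fun x => by
      have h0 : HasDerivAt (fun x : ℝ => (x : ℂ)) 1 x := (hasDerivAt_id (x : ℂ)).comp_ofReal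
      have h1 := (((h0.pow 2).const_mul (-(Complex.I * m))).add (h0.const_mul 2)).add_const
        (2 * (Complex.I * m))
      refine (h1.mul (hasDerivAt_cexp_mul_ofReal (Complex.I * m) x)).congr_deriv ?_
      rw [← mul_assoc Complex.I m x]
      simp
      linear_combination ((2 - (x : ℂ) ^ 2) * Complex.exp (Complex.I * m * x)) * hc) (by fun_prop)
  rw [lineMoment, h, e1, e2]
  push_cast
  ring

/-- The moment map on trigonometric polynomials. -/
noncomputable def trigMoments (d N : ℕ) :
    trigPoly d N →ₗ[ℂ] EuclideanSpace ℂ (Unit ⊕ Fin d ⊕ Unit) where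
  toFun p := moments p.1
  map_add' p q := moments_add (memLp_of_mem_trigPoly p.2) (memLp_of_mem_trigPoly q.2)
  map_smul' c p := moments_smul c p.1

lemma prod_lineMoment_single {m : ℤ} (hm : m = 1 ∨ m = -1) (j i : Fin d) (n : ℕ) :
    ∏ l, lineMoment ((Pi.single j m : Fin d → ℤ) l) (if l = i then n else 0) =
      if i = j then lineMoment m n * (2 * Real.pi : ℂ) ^ (d - 1) else 0 := by
  split_ifs with h
  · subst h
    rw [← Finset.mul_prod_erase _ _ (Finset.mem_univ i)]
    simp only [Pi.single_eq_same, if_true]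
    congr 1
    rw [Finset.prod_congr rfl (g := fun _ => (2 * Real.pi : ℂ)), Finset.prod_const,
      Finset.card_erase_of_mem (Finset.mem_univ i), Finset.card_univ, Fintype.card_fin]
    intro l hl
    have hl' := Finset.ne_of_mem_erase hl
    simp [hl', lineMoment_zero_zero]
  · refine Finset.prod_eq_zero (Finset.mem_univ j) ?_
    rw [Pi.single_eq_same, if_neg (Ne.symm h), lineMoment_unit_zero hm]

lemma moments_fourierMode_inl (i : Fin d) (k : Fin d → ℤ) (u : Unit) :
    moments (fourierMode k) (Sum.inl u) = ∏ l, lineMoment (k l) 0 := by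
  have h := integral_fourierMode_mul_pow k i 0
  simpa [moments_apply, collisionInvariant] using h

lemma moments_fourierMode_inr_inl (i : Fin d) (k : Fin d → ℤ) :
    moments (fourierMode k) (Sum.inr (Sum.inl i)) =
      ∏ l, lineMoment (k l) (if l = i then 1 else 0) := by
  have h := integral_fourierMode_mul_pow k i 1
  simpa [moments_apply, collisionInvariant] using h

lemma moments_fourierMode_inr_inr (k : Fin d → ℤ) (u : Unit) :
    moments (fourierMode k) (Sum.inr (Sum.inr u)) =
      ∑ i, ∏ l, lineMoment (k l) (if l = i then 2 else 0) := by
  simp only [← integral_fourierMode_mul_pow, moments_apply, collisionInvariant,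
    EuclideanSpace.real_norm_sq_eq]
  push_cast
  simp only [Finset.mul_sum]
  refine integral_finsetSum _ fun i _ => ?_
  have hc : Continuous fun v : EuclideanSpace ℝ (Fin d) => fourierMode k v * (v i : ℂ) ^ 2 :=
    (continuous_fourierMode k).mul (by fun_prop)
  exact memLp_one_iff_integrable.1 (memLp_of_continuous hc 1)

lemma moments_fourierMode_single {m : ℤ} (hm : m = 1 ∨ m = -1) (j : Fin d) :
    moments (fourierMode (Pi.single j m)) =
      (2 * Real.pi * (Complex.I * m) * (2 * Real.pi : ℂ) ^ (d - 1)) •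
          EuclideanSpace.single (Sum.inr (Sum.inl j)) 1 +
        (-4 * Real.pi * (2 * Real.pi : ℂ) ^ (d - 1)) •
          EuclideanSpace.single (Sum.inr (Sum.inr ())) 1 := by
  ext i
  rcases i with u | i | u
  · rw [moments_fourierMode_inl j]
    have h := prod_lineMoment_single hm j j 0
    simp only [ite_self, lineMoment_unit_zero hm, zero_mul] at h
    simp [h]
  · rw [moments_fourierMode_inr_inl, prod_lineMoment_single hm, lineMoment_unit_one hm]
    by_cases h : i = j <;> simp [h]
  · rw [moments_fourierMode_inr_inr]
    simp [prod_lineMoment_single hm, lineMoment_unit_two hm]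

lemma fourierMode_mem_trigPoly {k : Fin d → ℤ} {N : ℕ} (h : ∀ j, |k j| ≤ N) :
    fourierMode k ∈ trigPoly d N :=
  Submodule.subset_span ⟨k, fun j => abs_le.1 (h j), rfl⟩

/-- The difference of the modes `±e_j`, that is `2i sin v_j`, has only a `j`-th momentum, since the
energies cancel. Subtracting this direction from the moments of `e^{iv_j}`, whose mass is zero,
isolates the energy, and then the constant mode supplies the mass. -/
lemma trigMoments_surjective (hd : 1 ≤ d) : Function.Surjective (trigMoments d 1) := by
  rw [← LinearMap.range_eq_top]
  set W := LinearMap.range (trigMoments d 1)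
  have hW : ∀ k : Fin d → ℤ, (∀ j, |k j| ≤ (1 : ℕ)) → moments (fourierMode k) ∈ W := fun k hk =>
    ⟨⟨fourierMode k, fourierMode_mem_trigPoly hk⟩, rfl⟩
  have hsingle : ∀ (j : Fin d) (m : ℤ), (m = 1 ∨ m = -1) →
      moments (fourierMode (Pi.single j m)) ∈ W := fun j m hm => by
    refine hW _ fun l => ?_
    by_cases h : l = j
    · subst h; rcases hm with rfl | rfl <;> simp
    · simp [h]
  have hpi : (2 * Real.pi : ℂ) ≠ 0 := by simp [Real.pi_ne_zero]
  have h1 : ∀ j : Fin d, EuclideanSpace.single (Sum.inr (Sum.inl j)) (1 : ℂ) ∈ W := fun j => by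
    have h := W.sub_mem (hsingle j 1 (.inl rfl)) (hsingle j (-1) (.inr rfl))
    rw [moments_fourierMode_single (.inl rfl), moments_fourierMode_single (.inr rfl),
      add_sub_add_right_eq_sub, ← sub_smul] at h
    refine (W.smul_mem_iff ?_).1 h
    have : 2 * Real.pi * (Complex.I * ((1 : ℤ) : ℂ)) * (2 * Real.pi : ℂ) ^ (d - 1) -
        2 * Real.pi * (Complex.I * ((-1 : ℤ) : ℂ)) * (2 * Real.pi : ℂ) ^ (d - 1) =
        2 * (2 * Real.pi) * Complex.I * (2 * Real.pi : ℂ) ^ (d - 1) := by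
      push_cast; ring
    rw [this]
    exact mul_ne_zero (mul_ne_zero (mul_ne_zero two_ne_zero hpi) Complex.I_ne_zero)
      (pow_ne_zero _ hpi)
  have h2 : EuclideanSpace.single (Sum.inr (Sum.inr ())) (1 : ℂ) ∈ W := by
    have h := hsingle ⟨0, hd⟩ 1 (.inl rfl)
    rw [moments_fourierMode_single (.inl rfl), W.add_mem_iff_right (W.smul_mem _ (h1 _))] at h
    refine (W.smul_mem_iff ?_).1 h
    refine mul_ne_zero ?_ (pow_ne_zero _ hpi)
    simp [Real.pi_ne_zero]
  have hsum : ∀ u : EuclideanSpace ℂ (Unit ⊕ Fin d ⊕ Unit), u =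
      u (Sum.inl ()) • EuclideanSpace.single (Sum.inl ()) 1 +
        (∑ j, u (Sum.inr (Sum.inl j)) • EuclideanSpace.single (Sum.inr (Sum.inl j)) 1 +
        u (Sum.inr (Sum.inr ())) • EuclideanSpace.single (Sum.inr (Sum.inr ())) 1) := fun u => by
    have h := (EuclideanSpace.basisFun (Unit ⊕ Fin d ⊕ Unit) ℂ).sum_repr u
    simp only [Fintype.sum_sum_type, EuclideanSpace.basisFun_repr, EuclideanSpace.basisFun_apply,
      Finset.univ_unique, Finset.sum_singleton] at h
    exact h.symm
  have hrest := fun u : EuclideanSpace ℂ (Unit ⊕ Fin d ⊕ Unit) =>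
    W.add_mem (W.sum_mem fun j (_ : j ∈ Finset.univ) => W.smul_mem (u (Sum.inr (Sum.inl j))) (h1 j))
      (W.smul_mem (u (Sum.inr (Sum.inr ()))) h2)
  have h0 : EuclideanSpace.single (Sum.inl ()) (1 : ℂ) ∈ W := by
    have h := hW 0 (by simp)
    rw [hsum (moments (fourierMode 0)), W.add_mem_iff_left (hrest _)] at h
    refine (W.smul_mem_iff ?_).1 h
    rw [moments_fourierMode_inl ⟨0, hd⟩]
    exact Finset.prod_ne_zero_iff.2 fun l _ => by
      rw [Pi.zero_apply, lineMoment_zero_zero]; exact hpi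
  exact eq_top_iff.2 fun u _ => by
    rw [hsum u]
    exact W.add_mem (W.smul_mem _ h0) (hrest u)

/-- The canonical map from trigonometric polynomials to `L²` of the cube. -/
noncomputable def trigToLp (d N : ℕ) : trigPoly d N →ₗ[ℂ] Lp ℂ 2 (cubeMeasure d) where
  toFun p := (memLp_of_mem_trigPoly p.2).toLp p.1
  map_add' _ _ := MemLp.toLp_add _ _
  map_smul' _ _ := MemLp.toLp_const_smul _ _

lemma norm_toLp_eq_l2Norm {f : EuclideanSpace ℝ (Fin d) → ℂ} (hf : MemLp f 2 (cubeMeasure d)) :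
    ‖hf.toLp f‖ = l2Norm f :=
  Lp.norm_toLp f hf

/-- Prescribed moments are attained by a trigonometric polynomial of degree one, with a linear bound
on its norm. -/
lemma exists_trigPoly_moments_eq (hd : 1 ≤ d) :
    ∃ C : ℝ, 0 ≤ C ∧ ∀ U : EuclideanSpace ℂ (Unit ⊕ Fin d ⊕ Unit),
      ∃ p ∈ trigPoly d 1, moments p = U ∧ l2Norm p ≤ C * ‖U‖ := by
  obtain ⟨S, hS⟩ := (trigMoments d 1).exists_rightInverse_of_surjective
    (LinearMap.range_eq_top.2 (trigMoments_surjective hd))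
  -- A linear right inverse of the moment map is bounded because its domain is finite-dimensional;
  -- its operator norm is the constant.
  set T := LinearMap.toContinuousLinearMap (trigToLp d 1 ∘ₗ S)
  refine ⟨‖T‖, norm_nonneg _, fun U => ⟨S U, (S U).2, LinearMap.congr_fun hS U, ?_⟩⟩
  rw [← norm_toLp_eq_l2Norm (memLp_of_mem_trigPoly (S U).2)]
  exact T.le_opNorm U

/-! ### Constrained best approximation. -/

lemma finite_setOf_bounded (d N : ℕ) :
    {k : Fin d → ℤ | ∀ j, -(N : ℤ) ≤ k j ∧ k j ≤ N}.Finite :=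
  (Set.finite_Icc (fun _ : Fin d => -(N : ℤ)) fun _ => (N : ℤ)).subset fun _ hk =>
    ⟨fun j => (hk j).1, fun j => (hk j).2⟩

instance finiteDimensional_trigPoly (d N : ℕ) : FiniteDimensional ℂ (trigPoly d N) :=
  FiniteDimensional.span_of_finite ℂ ((finite_setOf_bounded d N).image _)

lemma isConstrainedBestApprox_iff {N : ℕ} {F : EuclideanSpace ℝ (Fin d) → ℂ}
    (hF : MemLp F 2 (cubeMeasure d)) {U : EuclideanSpace ℂ (Unit ⊕ Fin d ⊕ Unit)}
    {g : EuclideanSpace ℝ (Fin d) → ℂ} :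
    IsConstrainedBestApprox N F U g ↔ g ∈ trigPoly d N ∧ moments g = U ∧
      ∀ h ∈ trigPoly d N, moments h = U → l2Norm (g - F) ≤ l2Norm (h - F) := by
  refine and_congr_right fun hg => and_congr_right fun _ => forall₂_congr fun h hh => ?_
  rw [l2Norm, l2Norm, ENNReal.toReal_le_toReal ((memLp_of_mem_trigPoly hg).sub hF).2.ne
    ((memLp_of_mem_trigPoly hh).sub hF).2.ne]

/-- The admissible set is a particular solution `p` plus the kernel of the moment map, so the
minimizer comes from projecting `F - p` onto a finite-dimensional, hence complete, subspace of `L²`.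
-/
lemma exists_isConstrainedBestApprox (hd : 1 ≤ d) {N : ℕ} (hN : 1 ≤ N)
    {F : EuclideanSpace ℝ (Fin d) → ℂ} (hF : MemLp F 2 (cubeMeasure d))
    (U : EuclideanSpace ℂ (Unit ⊕ Fin d ⊕ Unit)) : ∃ g, IsConstrainedBestApprox N F U g := by
  obtain ⟨C, -, hC⟩ := exists_trigPoly_moments_eq hd
  obtain ⟨p, hp1, hpU, -⟩ := hC U
  have hp := trigPoly_mono hN hp1
  have hpL := memLp_of_mem_trigPoly hp
  set K := (LinearMap.ker (trigMoments d N)).map (trigToLp d N)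
  obtain ⟨w, hwK, hw⟩ := K.exists_norm_eq_iInf_of_complete_subspace
    (Submodule.complete_of_finiteDimensional K) ((hF.sub hpL).toLp _)
  obtain ⟨q, hq, rfl⟩ := hwK
  have hnorm : ∀ s : trigPoly d N, l2Norm (p + s.1 - F) =
      ‖(hF.sub hpL).toLp (F - p) - trigToLp d N s‖ := fun s => by
    rw [← norm_neg, neg_sub]
    change _ = ‖(memLp_of_mem_trigPoly s.2).toLp s.1 - (hF.sub hpL).toLp (F - p)‖
    rw [← MemLp.toLp_sub, norm_toLp_eq_l2Norm]
    congr 1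
    abel
  have hqL := memLp_of_mem_trigPoly q.2
  refine ⟨p + q, (isConstrainedBestApprox_iff hF).2 ⟨Submodule.add_mem _ hp q.2, ?_, ?_⟩⟩
  · have h0 : moments q.1 = 0 := hq
    rw [moments_add hpL hqL, h0, hpU, add_zero]
  · intro h hh hhU
    have hs : (⟨h - p, Submodule.sub_mem _ hh hp⟩ : trigPoly d N) ∈
        LinearMap.ker (trigMoments d N) := by
      change moments (h - p) = 0
      rw [moments_sub (memLp_of_mem_trigPoly hh) hpL, hhU, hpU, sub_self]
    have e : h - F = p + (⟨h - p, Submodule.sub_mem _ hh hp⟩ : trigPoly d N).1 - F := by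
      simp
    rw [e, hnorm, hnorm, hw]
    exact ciInf_le ⟨0, by rintro _ ⟨x, rfl⟩; exact norm_nonneg _⟩
      (⟨_, Submodule.mem_map_of_mem hs⟩ : K)

/-- By the parallelogram law the midpoint of two distinct minimizers would be strictly closer.
Equality in `L²` becomes equality of functions because both are trigonometric polynomials. -/
lemma IsConstrainedBestApprox.unique {N : ℕ} {F : EuclideanSpace ℝ (Fin d) → ℂ}
    (hF : MemLp F 2 (cubeMeasure d)) {U : EuclideanSpace ℂ (Unit ⊕ Fin d ⊕ Unit)}
    {g h : EuclideanSpace ℝ (Fin d) → ℂ} (hg : IsConstrainedBestApprox N F U g)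
    (hh : IsConstrainedBestApprox N F U h) : g = h := by
  obtain ⟨hg1, hgU, hgm⟩ := (isConstrainedBestApprox_iff hF).1 hg
  obtain ⟨hh1, hhU, hhm⟩ := (isConstrainedBestApprox_iff hF).1 hh
  have hgL := memLp_of_mem_trigPoly hg1
  have hhL := memLp_of_mem_trigPoly hh1
  have heq : l2Norm (g - F) = l2Norm (h - F) := le_antisymm (hgm h hh1 hhU) (hhm g hg1 hgU)
  have hm := hgm ((1 / 2 : ℂ) • (g + h)) (Submodule.smul_mem _ _ (Submodule.add_mem _ hg1 hh1)) (by
    rw [moments_smul, moments_add hgL hhL, hgU, hhU, ← two_smul ℂ U, smul_smul]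
    norm_num)
  have hmid : l2Norm ((1 / 2 : ℂ) • (g + h) - F) =
      ‖(1 / 2 : ℂ) • ((hgL.sub hF).toLp _ + (hhL.sub hF).toLp _)‖ := by
    rw [← MemLp.toLp_add, ← MemLp.toLp_const_smul, norm_toLp_eq_l2Norm]
    congr 1
    funext v
    simp only [Pi.sub_apply, Pi.smul_apply, Pi.add_apply, smul_eq_mul]
    ring
  rw [hmid, norm_smul] at hm
  have hpar := parallelogram_law_with_norm ℂ ((hgL.sub hF).toLp _) ((hhL.sub hF).toLp _)
  rw [norm_toLp_eq_l2Norm, norm_toLp_eq_l2Norm, ← heq] at hpar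
  norm_num at hm
  have h0 : (hgL.sub hF).toLp _ = (hhL.sub hF).toLp _ := by
    rw [← sub_eq_zero, ← norm_eq_zero]
    nlinarith [l2Norm_nonneg (g - F),
      norm_nonneg ((hgL.sub hF).toLp (g - F) - (hhL.sub hF).toLp (h - F))]
  have hae := (MemLp.toLp_eq_toLp_iff _ _).1 h0
  refine sub_eq_zero.1 (eq_zero_of_mem_trigPoly (Submodule.sub_mem _ hg1 hh1) ?_)
  filter_upwards [hae] with v hv
  simpa [sub_eq_zero] using hv

lemma existsUnique_isConstrainedBestApprox (hd : 1 ≤ d) {N : ℕ} (hN : 1 ≤ N)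
    {F : EuclideanSpace ℝ (Fin d) → ℂ} (hF : MemLp F 2 (cubeMeasure d))
    (U : EuclideanSpace ℂ (Unit ⊕ Fin d ⊕ Unit)) : ∃! g, IsConstrainedBestApprox N F U g := by
  obtain ⟨g, hg⟩ := exists_isConstrainedBestApprox hd hN hF U
  exact ⟨g, hg, fun h hh => hh.unique hF hg⟩

lemma l2Norm_sub_comm (f g : EuclideanSpace ℝ (Fin d) → ℂ) : l2Norm (f - g) = l2Norm (g - f) := by
  rw [l2Norm, l2Norm, eLpNorm_sub_comm]

/-- The constrained best approximation is as good as the Fourier projection, up to the defect of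
the prescribed moments. -/
lemma exists_l2Norm_sub_le_of_isConstrainedBestApprox (hd : 1 ≤ d) :
    ∃ C : ℝ, 0 ≤ C ∧ ∀ (N : ℕ) (F g : EuclideanSpace ℝ (Fin d) → ℂ)
      (U : EuclideanSpace ℂ (Unit ⊕ Fin d ⊕ Unit)), 1 ≤ N → MemLp F 2 (cubeMeasure d) →
      IsConstrainedBestApprox N F U g →
      l2Norm (F - g) ≤ C * (l2Norm (F - fourierProj N F) + ‖U - moments F‖) := by
  obtain ⟨C, hC0, hC⟩ := exists_trigPoly_moments_eq hd
  obtain ⟨M, hM0, hM⟩ := exists_norm_moments_le d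
  refine ⟨1 + C * M + C, by positivity, fun N F g U hN hF hg => ?_⟩
  obtain ⟨hg1, hgU, hgm⟩ := (isConstrainedBestApprox_iff hF).1 hg
  have hP := fourierProj_mem N F
  have hPL := memLp_of_mem_trigPoly hP
  -- The competitor is `P_N F + p`, with `p` carrying the missing moments; it is admissible since
  -- `p` has degree one and `N ≥ 1`.
  obtain ⟨p, hp1, hpU, hpC⟩ := hC (U - moments (fourierProj N F))
  have hp := trigPoly_mono hN hp1
  have hpL := memLp_of_mem_trigPoly hp
  have h1 := hgm (fourierProj N F + p) (Submodule.add_mem _ hP hp) (by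
    rw [moments_add hPL hpL, hpU, add_sub_cancel])
  have h2 : l2Norm (fourierProj N F + p - F) ≤ l2Norm (F - fourierProj N F) + l2Norm p := by
    rw [add_sub_right_comm, l2Norm_sub_comm F]
    exact l2Norm_add_le (hPL.sub hF) hpL
  have h3 : ‖U - moments (fourierProj N F)‖ ≤
      ‖U - moments F‖ + M * l2Norm (F - fourierProj N F) := by
    have e : U - moments (fourierProj N F) = (U - moments F) + moments (F - fourierProj N F) := by
      rw [moments_sub hF hPL]; abel
    rw [e]
    exact (norm_add_le _ _).trans (add_le_add_right (hM _ (hF.sub hPL)) _)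
  have h4 := mul_le_mul_of_nonneg_left h3 hC0
  rw [l2Norm_sub_comm]
  nlinarith [l2Norm_nonneg (F - fourierProj N F), norm_nonneg (U - moments F),
    mul_nonneg hC0 (l2Norm_nonneg (F - fourierProj N F)),
    mul_nonneg (mul_nonneg hC0 hM0) (norm_nonneg (U - moments F))]

end BoltzmannSpectral

/-! ### The error estimate. -/

theorem mainTheorem4 (d : ℕ) (hd : 1 ≤ d) (B : ℝ → ℝ → ℝ) (hB : IsCollisionKernel B)
    (r : ℕ) (hr : 1 ≤ r) (Ct : ℝ) :
    ∃ C : ℝ → ℝ → ℝ,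
      ∀ (N : ℕ) (R δ' : ℝ) (f : EuclideanSpace ℝ (Fin d) → ℂ),
        1 ≤ N → 0 < R → 0 ≤ δ' → MemHrp r f →
        ‖moments (collisionOp B R f)‖ ≤ Ct * (δ' / (N : ℝ) ^ r) →
        (∃! fNc, IsConstrainedBestApprox N f (moments f) fNc) ∧
        ∀ fNc, IsConstrainedBestApprox N f (moments f) fNc →
          MemHrp r (collisionOp B R fNc) ∧
          (∃! qNc, IsConstrainedBestApprox N (collisionOp B R fNc) 0 qNc) ∧
          ∀ qNc, IsConstrainedBestApprox N (collisionOp B R fNc) 0 qNc →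
            eLpNorm (collisionOp B R f - qNc) 2 (cubeMeasure d) ≤
              ENNReal.ofReal (C (hrpNorm r f) R / (N : ℝ) ^ r *
                (hrpNorm r f + hrpNorm r (collisionOp B R fNc) + δ')) := by
  have : Nonempty (Fin d) := ⟨⟨0, hd⟩⟩
  choose A hA0 hAmem hA using exists_collisionOp_bound (d := d) hB
  obtain ⟨K, hK0, hK⟩ := exists_l2Norm_sub_le_of_isConstrainedBestApprox hd
  obtain ⟨M, hM0, hM⟩ := exists_norm_moments_le d
  -- With `x = ‖f‖_{H^r}`, the first summand comes from the Lipschitz bound, entering directly and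
  -- through the moments of `Q(g,g)`; that bound is quadratic in `x`, and one factor `x` is left for
  -- the bracket. The others come from projecting `Q(g,g)` and from the moment hypothesis, where
  -- `|Ct|` allows for a negative constant.
  refine ⟨fun x R => (1 + K * M) * (A R * (2 + K * d) * (K * d) * x) + K * d + K * |Ct|, ?_⟩
  intro N R δ' f hN hR hδ hf hmom
  have hfL : MemLp f 2 (cubeMeasure d) := hf.2.1
  refine ⟨existsUnique_isConstrainedBestApprox hd hN hfL _, fun g hg => ?_⟩
  have hgL := memLp_of_mem_trigPoly hg.1
  have hQg := memHrp_of_mem_trigPoly (collisionOp_mem_trigPoly hB R hg.1) r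
  have hQgL : MemLp (collisionOp B R g) 2 (cubeMeasure d) := hQg.2.1
  refine ⟨hQg, existsUnique_isConstrainedBestApprox hd hN hQgL _, fun q hq => ?_⟩
  have hqL := memLp_of_mem_trigPoly hq.1
  have hQfL := hAmem R f hf.1 hfL
  suffices h : l2Norm (collisionOp B R f - q) ≤
      ((1 + K * M) * (A R * (2 + K * d) * (K * d) * hrpNorm r f) + K * d + K * |Ct|) /
        (N : ℝ) ^ r * (hrpNorm r f + hrpNorm r (collisionOp B R g) + δ') by
    rw [← ENNReal.ofReal_toReal (hQfL.sub hqL).2.ne]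
    exact ENNReal.ofReal_le_ofReal h
  set x := hrpNorm r f
  set h := hrpNorm r (collisionOp B R g)
  have hx : 0 ≤ x := hrpNorm_nonneg r f
  have hh : 0 ≤ h := hrpNorm_nonneg r _
  have hn : 1 ≤ (N : ℝ) ^ r := one_le_pow₀ (by exact_mod_cast hN)
  have hdN : (d : ℝ) / (N : ℝ) ^ r ≤ d := div_le_self (Nat.cast_nonneg d) hn
  have hAR := hA0 R
  have hfg : l2Norm (f - g) ≤ K * (d / (N : ℝ) ^ r * x) := by
    have := hK N f g _ hN hfL hg
    rw [sub_self, norm_zero, add_zero] at this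
    exact this.trans (mul_le_mul_of_nonneg_left (hf.l2Norm_sub_fourierProj_le hN) hK0)
  have hfx : l2Norm f ≤ x := hf.l2Norm_le
  have hgx : l2Norm g ≤ x + K * d * x := by
    have h1 : l2Norm g ≤ l2Norm f + l2Norm (g - f) := by
      simpa using l2Norm_add_le hfL (hgL.sub hfL)
    rw [l2Norm_sub_comm] at h1
    have h2 : K * (d / (N : ℝ) ^ r * x) ≤ K * (d * x) := by gcongr
    linarith
  have hQ : l2Norm (collisionOp B R f - collisionOp B R g) ≤
      A R * (2 + K * d) * (K * d) * x * x / (N : ℝ) ^ r := by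
    refine (hA R f g hf.1 hfL (isPeriodic_of_mem_trigPoly hg.1) hgL).trans ?_
    calc A R * ((l2Norm f + l2Norm g) * l2Norm (f - g))
        ≤ A R * ((x + (x + K * d * x)) * (K * (d / (N : ℝ) ^ r * x))) := by
          gcongr
          exact l2Norm_nonneg _
      _ = _ := by ring
  have hQq := hK N _ q 0 hN hQgL hq
  rw [zero_sub, norm_neg] at hQq
  have hproj : l2Norm (collisionOp B R g - fourierProj N (collisionOp B R g)) ≤
      d / (N : ℝ) ^ r * h := hQg.l2Norm_sub_fourierProj_le hN
  -- The hypothesis concerns the moments of `Q(f,f)`; continuity of the moments transfers it to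
  -- `Q(g,g)`.
  have hmg : ‖moments (collisionOp B R g)‖ ≤ |Ct| * (δ' / (N : ℝ) ^ r) +
      M * (A R * (2 + K * d) * (K * d) * x * x / (N : ℝ) ^ r) := by
    have h1 : ‖moments (collisionOp B R f - collisionOp B R g)‖ ≤ _ := hM _ (hQfL.sub hQgL)
    rw [moments_sub hQfL hQgL] at h1
    have h2 := norm_sub_norm_le (moments (collisionOp B R g)) (moments (collisionOp B R f))
    rw [norm_sub_rev] at h2
    have h3 : Ct * (δ' / (N : ℝ) ^ r) ≤ |Ct| * (δ' / (N : ℝ) ^ r) := by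
      gcongr
      exact le_abs_self Ct
    have h4 := mul_le_mul_of_nonneg_left hQ hM0
    linarith
  have htri : l2Norm (collisionOp B R f - q) ≤
      l2Norm (collisionOp B R f - collisionOp B R g) + l2Norm (collisionOp B R g - q) := by
    simpa using l2Norm_add_le (hQfL.sub hQgL) (hQgL.sub hqL)
  set E := A R * (2 + K * d) * (K * d) * x with hE
  have hE0 : 0 ≤ E := by positivity
  calc l2Norm (collisionOp B R f - q)
      ≤ E * x / (N : ℝ) ^ r + K * (d / (N : ℝ) ^ r * h +
          (|Ct| * (δ' / (N : ℝ) ^ r) + M * (E * x / (N : ℝ) ^ r))) := by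
        have := mul_le_mul_of_nonneg_left (add_le_add hproj hmg) hK0
        linarith
    _ = ((1 + K * M) * E * x + K * d * h + K * |Ct| * δ') / (N : ℝ) ^ r := by ring
    -- The expanded product contains the left-hand side; all additional cross terms are nonnegative.
    _ ≤ ((1 + K * M) * E + K * d + K * |Ct|) * (x + h + δ') / (N : ℝ) ^ r := by
        refine div_le_div_of_nonneg_right ?_ (by positivity)
        have t1 : 0 ≤ (1 + K * M) * E := by positivity
        have t2 : 0 ≤ K * d := by positivity
        have t3 : 0 ≤ K * |Ct| := by positivity
        nlinarith [mul_nonneg t1 hh, mul_nonneg t1 hδ, mul_nonneg t2 hx, mul_nonneg t2 hδ,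
          mul_nonneg t3 hx, mul_nonneg t3 hh]
    _ = _ := by ring
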